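/- A quiver here is a finite quiver without loops and without oriented cycles of length two. Mutation of such a quiver at a vertex $k$ adds one arrow $i\to j$ for every path $i\to k\to j$, then reverses all arrows at $k$, and then removes oriented 2-cycles one after another. (If there are no multiple arrows, each path $i\to k\to j$ thus removes the arrow $j\to i$ if there is one, and adds an arrow $i\to j$ otherwise.) The mutation class of a quiver $Q$ consists of all quivers obtained from $Q$ by a finite number of mutations. A quiver is of type $D_n$ if it is an orientation of the Dynkin diagram $D_n$ or, more generally, lies in the mutation class of such an orientation. Let $n\ge 4$ and let $Q$ be any quiver of type $D_n$. Then the mutation class of $Q$ contains only finitely many quivers up to isomorphism, and the number $d(n)$ of isomorphism classes of quivers in it is $$d(n)=\begin{cases}\dfrac{1}{2n}\displaystyle\sum_{d\mid n}\varphi(n/d)\binom{2d}{d} & \text{if } n\ge 5,\\[2ex] 6 & \text{if } n=4,\end{cases}$$ where $\varphi$ is Euler's totient function and the sum runs over the positive divisors $d$ of $n$. -/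

import Mathlib

/-- A quiver on the vertex set `V` without loops and without oriented cycles of length two;
`arrows i j` is the number of arrows from `i` to `j`. -/
@[ext]
structure ClusterQuiver (V : Type*) where
  arrows : V → V → ℕ
  no_loop : ∀ i, arrows i i = 0
  no_two_cycle : ∀ i j, arrows i j = 0 ∨ arrows j i = 0

namespace ClusterQuiver

variable {V : Type*}

/-- Mutation at the vertex `k`, the new vertex again being called `k`. Arrows at `k` are reversed.
For `i, j ≠ k`, one arrow `i → j` is added for each path `i → k → j`, and afterwards arrows
`i → j` and `j → i` are cancelled in pairs: this is the truncated subtraction. If there are no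
multiple arrows, a path `i → k → j` thus removes the arrow `j → i` if there is one, and otherwise
adds an arrow `i → j`. -/
def mutate [DecidableEq V] (Q : ClusterQuiver V) (k : V) : ClusterQuiver V where
  arrows i j :=
    if i = k ∨ j = k then Q.arrows j i
    else (Q.arrows i j + Q.arrows i k * Q.arrows k j) -
      (Q.arrows j i + Q.arrows j k * Q.arrows k i)
  no_loop i := by
    split_ifs
    · exact Q.no_loop i
    · exact Nat.sub_self _
  no_two_cycle i j := by
    by_cases h : i = k ∨ j = k
    · rw [if_pos h, if_pos h.symm]
      exact Q.no_two_cycle j i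
    · rw [if_neg h, if_neg (fun h' => h h'.symm)]
      omega

/-- `Q'` can be obtained from `Q` by a finite number of mutations. -/
def MutationEquiv [DecidableEq V] (Q Q' : ClusterQuiver V) : Prop :=
  Relation.ReflTransGen (fun R R' : ClusterQuiver V => ∃ k, R' = R.mutate k) Q Q'

/-- The mutation class of `Q`: all quivers mutation equivalent to `Q`. -/
def mutationClass [DecidableEq V] (Q : ClusterQuiver V) : Set (ClusterQuiver V) :=
  {Q' | Q.MutationEquiv Q'}

/-- Isomorphism of quivers on the vertex set `V`. -/
def isoSetoid (V : Type*) : Setoid (ClusterQuiver V) where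
  r Q Q' := ∃ σ : Equiv.Perm V, ∀ i j, Q'.arrows (σ i) (σ j) = Q.arrows i j
  iseqv :=
    { refl := fun _ => ⟨Equiv.refl V, fun _ _ => rfl⟩
      symm := by
        rintro Q Q' ⟨σ, h⟩
        refine ⟨σ.symm, fun i j => ?_⟩
        rw [← h, Equiv.apply_symm_apply, Equiv.apply_symm_apply]
      trans := by
        rintro Q Q' Q'' ⟨σ, h⟩ ⟨τ, h'⟩
        refine ⟨σ.trans τ, fun i j => ?_⟩
        rw [Equiv.trans_apply, Equiv.trans_apply, h', h] }

/-- The isomorphism classes of quivers in the mutation class of `Q`. -/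
def MutationIsoClasses [DecidableEq V] (Q : ClusterQuiver V) : Type _ :=
  Quotient ((isoSetoid V).comap (Subtype.val : Q.mutationClass → ClusterQuiver V))

/-- `Q` is an orientation of the Dynkin diagram `D_n`: after numbering the vertices, the number of
arrows joining two distinct vertices (in either direction) is the number of edges joining them in
the Dynkin diagram, that is, minus the corresponding entry of the Cartan matrix. -/
def IsDynkinD (n : ℕ) (Q : ClusterQuiver V) : Prop :=
  ∃ e : V ≃ Fin n, ∀ i j, i ≠ j →
    (Q.arrows i j : ℤ) + (Q.arrows j i : ℤ) = -CartanMatrix.D n (e i) (e j)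

/-- `Q` is of type `D_n`: it is mutation equivalent to an orientation of the Dynkin diagram `D_n`
(in particular, every such orientation is of type `D_n`). -/
def IsOfTypeD [DecidableEq V] (n : ℕ) (Q : ClusterQuiver V) : Prop :=
  ∃ Q₀ : ClusterQuiver V, Q₀.IsDynkinD n ∧ Q₀.MutationEquiv Q

end ClusterQuiver

/-! Quivers of type D_n come from triangulations of an n-gon with one puncture: each triangle
contributes an oriented 3-cycle on those of its sides that are arcs, and mutation at an arc is its
flip. Cut along the arcs ending in the puncture (the spokes), a triangulation becomes a cyclic list
of triangulated polygons, a `Forest`. Nodes of the trees are arcs, leaves are boundary edges, and an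
entry `(T, s)` adds the triangle formed by the previous spoke, the root edge of `T` and `s`. A sole
spoke lies in a self-folded triangle; the spoke and the loop around it then have the same arrows
(hence `fatMat`) and may be exchanged, which is the second clause of `Forest.Equiv`.

Flips realise mutations (`Forest.Flip.skew_mutate`), every orientation of D_n comes from a forest
(`IsDynkinD.exists_forest`), and any two forests are linked by flips up to relabelling
(`Forest.exists_reach_relabel`). For n ≥ 5 a quiver determines its forest up to `Forest.Equiv`:
flips are invertible and unique, so this rigidity passes along mutations and needs checking only for
the linear orientation of D_n (`Forest.rigid_comb`).

In postfix notation an unlabelled forest is a word with n letters of each of two kinds. By the cycle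
lemma, forests up to rotation are the same as balanced words up to rotation
(`Forest.isRotated_of_enc`, `Forest.exists_isRotated_enc`), and Burnside's lemma counts these
necklaces (`BalancedWord.card_necklaces`).

For n = 4 rigidity fails because of the threefold symmetry of D_4, and the necklace count would be
10. There the six quivers are listed and their closure under mutation is a finite check. -/

namespace ClusterQuiver

/-! ### Skew-symmetric matrices of quivers, and flips in a quadrilateral. -/

variable {V : Type*}

/-- The skew-symmetric matrix of a quiver. -/
def skew (Q : ClusterQuiver V) (i j : V) : ℤ := Q.arrows i j - Q.arrows j i

theorem arrows_eq_max (Q : ClusterQuiver V) (i j : V) :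
    (Q.arrows i j : ℤ) = max (Q.skew i j) 0 := by
  have := Q.no_two_cycle i j
  unfold skew
  omega

theorem skew_swap (Q : ClusterQuiver V) (i j : V) : Q.skew j i = -Q.skew i j := by
  unfold skew; ring

theorem ext_skew {Q Q' : ClusterQuiver V} (h : Q.skew = Q'.skew) : Q = Q' := by
  ext i j
  have h1 := Q.arrows_eq_max i j
  rw [h, ← Q'.arrows_eq_max i j] at h1
  exact_mod_cast h1

theorem skew_mutate_self [DecidableEq V] (Q : ClusterQuiver V) {k i j : V} (h : i = k ∨ j = k) :
    (Q.mutate k).skew i j = -Q.skew i j := by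
  simp only [skew, mutate, if_pos h, if_pos h.symm]
  ring

theorem skew_mutate_of_ne [DecidableEq V] (Q : ClusterQuiver V) {k i j : V}
    (hi : i ≠ k) (hj : j ≠ k) :
    (Q.mutate k).skew i j = Q.skew i j +
      (Q.arrows i k * Q.arrows k j - Q.arrows j k * Q.arrows k i) := by
  simp only [skew, mutate, hi, hj, or_self, if_false]
  have h (a b : ℕ) : ((a - b : ℕ) : ℤ) - ((b - a : ℕ) : ℤ) = a - b := by omega
  rw [h]
  push_cast
  ring

theorem mutate_mutate [DecidableEq V] (Q : ClusterQuiver V) (k : V) :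
    (Q.mutate k).mutate k = Q := by
  apply ext_skew
  funext i j
  by_cases h : i = k ∨ j = k
  · rw [skew_mutate_self _ h, skew_mutate_self _ h, neg_neg]
  · push Not at h
    rw [skew_mutate_of_ne _ h.1 h.2, skew_mutate_of_ne _ h.1 h.2]
    simp only [mutate, true_or, or_true, if_true]
    ring

/-- The bilinear form `u ∧ v`. -/
def wedge (u v : V → ℤ) (i j : V) : ℤ := u i * v j - v i * u j

/-- The contribution of an oriented triangle `a → b → c → a`. -/
def tri (a b c : V → ℤ) : V → V → ℤ := wedge a b + wedge b c + wedge c a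

theorem tri_apply (a b c : V → ℤ) (i j : V) : tri a b c i j =
    (a i * b j - b i * a j) + (b i * c j - c i * b j) + (c i * a j - a i * c j) := rfl

theorem tri_rotate (a b c : V → ℤ) : tri a b c = tri b c a := by
  funext i j; simp only [tri_apply]; ring

variable [DecidableEq V]

/-- The indicator function of a vertex. -/
def pt (x : V) : V → ℤ := Pi.single x 1

@[simp] theorem pt_self (x : V) : pt x x = 1 := by simp [pt]

theorem pt_of_ne {x i : V} (h : i ≠ x) : pt x i = 0 := by simp [pt, h]

theorem pt_apply (x i : V) : pt x i = if i = x then 1 else 0 := by simp [pt, Pi.single_apply]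

theorem pt_nonneg (x i : V) : 0 ≤ pt x i := by rw [pt_apply]; split_ifs <;> simp

/-- The matrices `M` and `M'` are related by the flip of the diagonal `x` of a quadrilateral whose
sides are, in cyclic order, `a`, `b`, `c`, `d`. -/
def IsFlip (x : V) (M M' : V → V → ℤ) : Prop :=
  ∃ (a b c d : V → ℤ) (R : V → V → ℤ),
    ((∀ i, 0 ≤ a i) ∧ (∀ i, 0 ≤ b i) ∧ (∀ i, 0 ≤ c i) ∧ (∀ i, 0 ≤ d i)) ∧
    (a x = 0 ∧ b x = 0 ∧ c x = 0 ∧ d x = 0) ∧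
    (∀ i, (a i + c i) * (b i + d i) = 0) ∧
    (∀ j, R x j = 0 ∧ R j x = 0) ∧
    M = tri (pt x) a b + tri (pt x) c d + R ∧ M' = tri (pt x) b c + tri (pt x) d a + R

theorem IsFlip.symm {x : V} {M M' : V → V → ℤ} (h : IsFlip x M M') : IsFlip x M' M := by
  obtain ⟨a, b, c, d, R, ⟨ha, hb, hc, hd⟩, ⟨ha', hb', hc', hd'⟩, h0, hR, hM, hM'⟩ := h
  refine ⟨b, c, d, a, R, ⟨hb, hc, hd, ha⟩, ⟨hb', hc', hd', ha'⟩, fun i => ?_, hR, hM', ?_⟩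
  · rw [mul_comm, add_comm (c i)]
    exact h0 i
  · rw [hM, add_comm (tri (pt x) a b)]

theorem IsFlip.add {x : V} {M M' S : V → V → ℤ} (h : IsFlip x M M')
    (hS : ∀ j, S x j = 0 ∧ S j x = 0) : IsFlip x (M + S) (M' + S) := by
  obtain ⟨a, b, c, d, R, h1, h2, h3, hR, hM, hM'⟩ := h
  refine ⟨a, b, c, d, R + S, h1, h2, h3, fun j => ?_, ?_, ?_⟩
  · simp [hR j, hS j]
  · rw [hM, add_assoc]
  · rw [hM', add_assoc]

/-- The product condition prevents cancellation at `x`: arrows out of `x` are counted by `a + c`,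
arrows into `x` by `b + d`. Paths through `x` add the wedge of `b + d` with `a + c`, which cancels
`a ∧ b` and `c ∧ d` and leaves `b ∧ c` and `d ∧ a`, the outer arrows of the two new triangles. -/
theorem IsFlip.skew_mutate {x : V} {M M' : V → V → ℤ} (h : IsFlip x M M')
    {Q : ClusterQuiver V} (hQ : Q.skew = M) : (Q.mutate x).skew = M' := by
  obtain ⟨a, b, c, d, R, ⟨ha, hb, hc, hd⟩, ⟨ha', hb', hc', hd'⟩, h0, hR, hM, hM'⟩ := h
  have hxj (j : V) : Q.skew x j = (a j + c j) - (b j + d j) := by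
    rw [hQ, hM]
    simp only [Pi.add_apply, tri_apply, ha', hb', hc', hd', (hR j).1, pt_self]
    ring
  have hmax (p q : ℤ) (hp : 0 ≤ p) (hq : 0 ≤ q) (h : p * q = 0) : max (p - q) 0 = p := by
    rcases mul_eq_zero.1 h with rfl | rfl <;> simp [hp, hq]
  have hout (j : V) : (Q.arrows x j : ℤ) = a j + c j := by
    rw [arrows_eq_max, hxj]
    exact hmax _ _ (add_nonneg (ha j) (hc j)) (add_nonneg (hb j) (hd j)) (h0 j)
  have hin (j : V) : (Q.arrows j x : ℤ) = b j + d j := by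
    rw [arrows_eq_max, skew_swap, hxj, neg_sub]
    exact hmax _ _ (add_nonneg (hb j) (hd j)) (add_nonneg (ha j) (hc j)) (by rw [mul_comm, h0 j])
  funext i j
  by_cases h : i = x ∨ j = x
  · rw [skew_mutate_self _ h, hQ, hM, hM']
    rcases h with rfl | rfl
    · simp only [Pi.add_apply, tri_apply, ha', hb', hc', hd', (hR j).1, pt_self]
      ring
    · simp only [Pi.add_apply, tri_apply, ha', hb', hc', hd', (hR i).2, pt_self]
      ring
  · push Not at h
    rw [skew_mutate_of_ne _ h.1 h.2, hin, hin, hout, hout, hQ, hM, hM']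
    simp only [Pi.add_apply, tri_apply, pt_of_ne h.1, pt_of_ne h.2]
    ring

end ClusterQuiver

/-! ### Triangulated polygons as binary trees, with tree rotations as flips. -/

namespace BinaryTree

open ClusterQuiver

variable {α β V : Type*}

/-- The labels of a tree in postfix order. -/
def labels : BinaryTree α → List α
  | nil => []
  | node a l r => l.labels ++ r.labels ++ [a]

/-- The tree rotation which moves the node labelled `x`, keeping its parent. -/
inductive Rot (x : α) : BinaryTree α → BinaryTree α → Prop
  | right (y : α) (A B C : BinaryTree α) :
      Rot x (node y (node x A B) C) (node y A (node x B C))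
  | left (y : α) (A B C : BinaryTree α) :
      Rot x (node y A (node x B C)) (node y (node x A B) C)
  | congr_left (y : α) {L L' : BinaryTree α} (R : BinaryTree α) (h : Rot x L L') :
      Rot x (node y L R) (node y L' R)
  | congr_right (y : α) (L : BinaryTree α) {R R' : BinaryTree α} (h : Rot x R R') :
      Rot x (node y L R) (node y L R')

namespace Rot

variable {x : α} {T T' T'' : BinaryTree α}

theorem symm (h : Rot x T T') : Rot x T' T := by
  induction h with
  | right y A B C => exact .left y A B C
  | left y A B C => exact .right y A B C
  | congr_left y R _ ih => exact .congr_left y R ih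
  | congr_right y L _ ih => exact .congr_right y L ih

theorem labels_perm (h : Rot x T T') : T.labels.Perm T'.labels := by
  classical
  rw [List.perm_iff_count]
  intro a
  induction h with
  | right y A B C | left y A B C => simp only [labels, List.count_append]; omega
  | congr_left y R _ ih | congr_right y L _ ih => simp only [labels, List.count_append]; omega

theorem mem_labels (h : Rot x T T') : x ∈ T.labels := by
  induction h <;> simp_all [labels]

/-- The root edge is a side of the polygon, so it is not flipped inside the tree; moves of the root
are left to `Forest.Step`. -/
theorem root_ne {L R : BinaryTree α} {y : α} (h : Rot x (node y L R) T')
    (hT : (node y L R).labels.Nodup) : x ≠ y := by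
  rintro rfl
  cases h with
  | right A B => simp [labels, List.nodup_append] at hT
  | left B C => simp [labels, List.nodup_append] at hT
  | congr_left _ _ h =>
    have := h.mem_labels
    simp only [labels, List.nodup_append, List.mem_append, List.mem_singleton] at hT
    exact hT.2.2 x (Or.inl this) x rfl rfl
  | congr_right _ _ h =>
    have := h.mem_labels
    simp only [labels, List.nodup_append, List.mem_append, List.mem_singleton] at hT
    exact hT.2.2 x (Or.inr this) x rfl rfl

/-- The root label plays no part in a rotation. This is what makes rotations compatible with
exchanging the loop and the spoke of a self-folded triangle. -/
theorem exists_node {L R : BinaryTree α} {y : α} (h : Rot x (node y L R) T') :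
    ∃ L' R', T' = node y L' R' ∧ ∀ z, Rot x (node z L R) (node z L' R') := by
  cases h with
  | right A B => exact ⟨_, _, rfl, fun z => .right z _ _ _⟩
  | left B C => exact ⟨_, _, rfl, fun z => .left z _ _ _⟩
  | congr_left _ _ h => exact ⟨_, _, rfl, fun z => .congr_left z _ h⟩
  | congr_right _ _ h => exact ⟨_, _, rfl, fun z => .congr_right z _ h⟩

theorem not_mem_of_nodup {L R : BinaryTree α} {y : α} (hT : (node y L R).labels.Nodup) :
    L.labels.Nodup ∧ R.labels.Nodup ∧ y ∉ L.labels ∧ y ∉ R.labels ∧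
      (∀ i ∈ L.labels, i ∉ R.labels) := by
  simp only [labels, List.nodup_append, List.mem_append, List.mem_singleton] at hT
  refine ⟨hT.1.1, hT.1.2.1, fun h => hT.2.2 y (Or.inl h) y rfl rfl,
    fun h => hT.2.2 y (Or.inr h) y rfl rfl, fun i h h' => hT.1.2.2 i h i h' rfl⟩

theorem unique (h : Rot x T T') (h' : Rot x T T'') (hT : T.labels.Nodup) : T' = T'' := by
  induction h generalizing T'' with
  | right y A B C =>
    obtain ⟨h1, h2, h3, h4, h5⟩ := not_mem_of_nodup hT
    cases h' with
    | right => rfl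
    | left A B => exact absurd (show x ∈ _ by simp [labels]) (h5 x (by simp [labels]))
    | congr_left _ _ h => exact absurd rfl (h.root_ne h1)
    | congr_right _ _ h => exact absurd h.mem_labels (h5 x (by simp [labels]))
  | left y A B C =>
    obtain ⟨h1, h2, h3, h4, h5⟩ := not_mem_of_nodup hT
    cases h' with
    | left => rfl
    | right A B => exact absurd (show x ∈ _ by simp [labels]) (h5 x (by simp [labels]))
    | congr_right _ _ h => exact absurd rfl (h.root_ne h2)
    | congr_left _ _ h => exact absurd (show x ∈ _ by simp [labels]) (h5 x h.mem_labels)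
  | congr_left y R h ih =>
    obtain ⟨h1, h2, h3, h4, h5⟩ := not_mem_of_nodup hT
    cases h' with
    | right A B => exact absurd rfl (h.root_ne h1)
    | left A B => exact absurd (show x ∈ _ by simp [labels]) (h5 x h.mem_labels)
    | congr_right _ _ h' => exact absurd h'.mem_labels (h5 x h.mem_labels)
    | congr_left _ _ h' => rw [ih h' h1]
  | congr_right y L h ih =>
    obtain ⟨h1, h2, h3, h4, h5⟩ := not_mem_of_nodup hT
    cases h' with
    | left A B => exact absurd rfl (h.root_ne h2)
    | right A B => exact absurd h.mem_labels (h5 x (by simp [labels]))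
    | congr_left _ _ h' => exact absurd h.mem_labels (h5 x h'.mem_labels)
    | congr_right _ _ h' => rw [ih h' h2]

theorem exists_of_mem {x : α} : ∀ {T : BinaryTree α}, x ∈ T.labels →
    (∃ L R, T = node x L R) ∨ ∃ T', Rot x T T'
  | nil, h => by simp [labels] at h
  | node y L R, h => by
    simp only [labels, List.mem_append, List.mem_singleton] at h
    rcases h with (h | h) | rfl
    · right
      rcases exists_of_mem h with ⟨A, B, rfl⟩ | ⟨L', h'⟩
      · exact ⟨_, .right y A B R⟩
      · exact ⟨_, .congr_left y R h'⟩
    · right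
      rcases exists_of_mem h with ⟨A, B, rfl⟩ | ⟨R', h'⟩
      · exact ⟨_, .left y L A B⟩
      · exact ⟨_, .congr_right y L h'⟩
    · exact Or.inl ⟨L, R, rfl⟩

end Rot

variable [DecidableEq V]

/-- The indicator function of the root label of a tree. -/
def topInd : BinaryTree V → V → ℤ
  | nil => 0
  | node a _ _ => pt a

@[simp] theorem topInd_node (a : V) (l r : BinaryTree V) : (node a l r).topInd = pt a := rfl

@[simp] theorem topInd_nil : (nil : BinaryTree V).topInd = 0 := rfl

/-- The sum of the triangles of a tree. -/
def mat : BinaryTree V → V → V → ℤ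
  | nil => 0
  | node a l r => tri (pt a) l.topInd r.topInd + l.mat + r.mat

/-- The sum of the triangles of a tree, the root being replaced by `D`. -/
def fatMat (D : V → ℤ) : BinaryTree V → V → V → ℤ
  | nil => 0
  | node _ l r => tri D l.topInd r.topInd + l.mat + r.mat

theorem mat_node (a : V) (l r : BinaryTree V) :
    (node a l r).mat = tri (pt a) l.topInd r.topInd + l.mat + r.mat := rfl

theorem mat_eq_fatMat (T : BinaryTree V) : T.mat = T.fatMat T.topInd := by
  cases T <;> rfl

theorem topInd_nonneg (T : BinaryTree V) (i : V) : 0 ≤ T.topInd i := by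
  cases T
  · exact le_rfl
  · exact pt_nonneg _ _

theorem topInd_eq_zero {T : BinaryTree V} {i : V} (h : i ∉ T.labels) : T.topInd i = 0 := by
  cases T with
  | nil => rfl
  | node a l r => exact pt_of_ne (by rintro rfl; simp [labels] at h)

theorem mat_eq_zero {T : BinaryTree V} {i : V} (h : i ∉ T.labels) (j : V) :
    T.mat i j = 0 ∧ T.mat j i = 0 := by
  induction T with
  | nil => exact ⟨rfl, rfl⟩
  | node a l r hl hr =>
    simp only [labels, List.mem_append, List.mem_singleton, not_or] at h
    simp only [mat, Pi.add_apply, tri_apply, pt_of_ne h.2, topInd_eq_zero h.1.1,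
      topInd_eq_zero h.1.2, hl h.1.1, hr h.1.2]
    simp

theorem mat_swap (T : BinaryTree V) (i j : V) : T.mat i j = -T.mat j i := by
  induction T with
  | nil => rfl
  | node a l r hl hr =>
    simp only [mat, Pi.add_apply, tri_apply, hl, hr]
    ring

theorem Rot.topInd_eq {x : V} {T T' : BinaryTree V} (h : Rot x T T') : T.topInd = T'.topInd := by
  cases h <;> rfl

theorem Rot.topInd_self {x : V} {T T' : BinaryTree V} (h : Rot x T T') (hT : T.labels.Nodup) :
    T.topInd x = 0 := by
  cases T with
  | nil => rfl
  | node a l r => exact pt_of_ne (h.root_ne hT)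

/-- The general `D` covers the case of a sole spoke, where the root stands for the loop and the
spoke together. It may be nonzero outside the tree, but on the labels it must vanish away from the
root. -/
theorem Rot.isFlip {x : V} {T T' : BinaryTree V} (h : Rot x T T') (hT : T.labels.Nodup)
    {D : V → ℤ} (hD0 : ∀ i, 0 ≤ D i) (hD : ∀ i ∈ T.labels, T.topInd i = 0 → D i = 0) :
    IsFlip x (T.fatMat D) (T'.fatMat D) := by
  have base (D : V → ℤ) (hD0 : ∀ i, 0 ≤ D i) (y : V) (A B C : BinaryTree V)
      (hT : (node y (node x A B) C).labels.Nodup)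
      (hD : ∀ i ∈ (node y (node x A B) C).labels, (node y (node x A B) C).topInd i = 0 → D i = 0) :
      IsFlip x ((node y (node x A B) C).fatMat D) ((node y A (node x B C)).fatMat D) := by
    obtain ⟨h1, h2, h3, h4, h5⟩ := Rot.not_mem_of_nodup hT
    obtain ⟨g1, g2, g3, g4, g5⟩ := Rot.not_mem_of_nodup h1
    simp only [labels, List.mem_append, List.mem_singleton, not_or, topInd_node] at hD h3 h5
    have hxC : x ∉ C.labels := h5 x (Or.inr rfl)
    have hDx : D x = 0 := hD x (by simp) (pt_of_ne (Ne.symm h3.2))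
    have hDC (i : V) (hi : i ∈ C.labels) : D i = 0 :=
      hD i (by simp [hi]) (pt_of_ne (by rintro rfl; exact h4 hi))
    have hDA (i : V) (hi : i ∈ A.labels) : D i = 0 :=
      hD i (by simp [hi]) (pt_of_ne (by rintro rfl; exact h3.1.1 hi))
    -- The arc `x` is a diagonal of the quadrilateral whose sides are the root edges of `A`, `B`,
    -- `C` and the parent, represented by `D`.
    refine ⟨A.topInd, B.topInd, C.topInd, D, A.mat + B.mat + C.mat,
      ⟨topInd_nonneg A, topInd_nonneg B, topInd_nonneg C, hD0⟩,
      ⟨topInd_eq_zero g3, topInd_eq_zero g4, topInd_eq_zero hxC, hDx⟩, fun i => ?_, fun j => ?_,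
      ?_, ?_⟩
    · by_cases hA : i ∈ A.labels
      · rw [topInd_eq_zero (g5 i hA), hDA i hA]; simp
      · by_cases hC : i ∈ C.labels
        · rw [topInd_eq_zero (T := B) (fun hB => h5 i (Or.inl (Or.inr hB)) hC), hDC i hC]; simp
        · rw [topInd_eq_zero hA, topInd_eq_zero hC]; simp
    · simp [mat_eq_zero g3, mat_eq_zero g4, mat_eq_zero hxC]
    · simp only [fatMat, mat, topInd_node]
      rw [tri_rotate D]
      abel
    · simp only [fatMat, mat, topInd_node]
      rw [tri_rotate D A.topInd (pt x), tri_rotate A.topInd (pt x) D]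
      abel
  induction h generalizing D with
  | right y A B C => exact base D hD0 y A B C hT hD
  | left y A B C =>
    have hp := (Rot.left (x := x) y A B C).labels_perm
    exact (base D hD0 y A B C (hp.nodup_iff.1 hT) (fun i hi => hD i (hp.mem_iff.2 hi))).symm
  | congr_left y R h ih =>
    have hxy := (Rot.congr_left y R h).root_ne hT
    obtain ⟨h1, h2, h3, h4, h5⟩ := Rot.not_mem_of_nodup hT
    rename_i L L'
    have hDx : D x = 0 := hD x (by simp [labels, h.mem_labels]) (pt_of_ne hxy)
    have hx := h5 x h.mem_labels
    -- Inside the subtree the root is an ordinary arc again, and everything outside the subtree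
    -- vanishes at `x`.
    have := (ih h1 (D := L.topInd) (topInd_nonneg L) (fun i _ h => h)).add
      (S := tri D L.topInd R.topInd + R.mat)
      (fun j => by simp [tri_apply, hDx, h.topInd_self h1, topInd_eq_zero hx, mat_eq_zero hx])
    rw [← mat_eq_fatMat, h.topInd_eq, ← mat_eq_fatMat] at this
    simp only [fatMat, h.topInd_eq]
    convert this using 1 <;> abel
  | congr_right y L h ih =>
    have hxy := (Rot.congr_right y L h).root_ne hT
    obtain ⟨h1, h2, h3, h4, h5⟩ := Rot.not_mem_of_nodup hT
    rename_i R R'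
    have hDx : D x = 0 := hD x (by simp [labels, h.mem_labels]) (pt_of_ne hxy)
    have hx : x ∉ L.labels := fun hL => h5 x hL h.mem_labels
    have := (ih h2 (D := R.topInd) (topInd_nonneg R) (fun i _ h => h)).add
      (S := tri D L.topInd R.topInd + L.mat)
      (fun j => by simp [tri_apply, hDx, h.topInd_self h2, topInd_eq_zero hx, mat_eq_zero hx])
    rw [← mat_eq_fatMat, h.topInd_eq, ← mat_eq_fatMat] at this
    simp only [fatMat, h.topInd_eq]
    convert this using 1 <;> abel

end BinaryTree

/-! ### Triangulations of the punctured polygon: existence and uniqueness of flips. -/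

namespace ClusterQuiver

open BinaryTree List

variable {V : Type*}

/-- A triangulation of a punctured polygon, cut along the arcs ending in the puncture (the spokes).
The pair `(T, s)` stands for the region which ends in the spoke `s`, and whose triangulation is
given by the tree `T`. The regions are arranged cyclically. -/
abbrev Forest (V : Type*) := List (BinaryTree V × V)

namespace Forest

/-- The labels of a forest. -/
def labels (F : Forest V) : List V := F.flatMap fun p => p.1.labels ++ [p.2]

@[simp] theorem labels_cons (T : BinaryTree V) (s : V) (F : Forest V) :
    labels ((T, s) :: F) = T.labels ++ s :: labels F := by simp [labels]

@[simp] theorem labels_nil : labels ([] : Forest V) = [] := rfl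

theorem labels_perm_of_perm {F G : Forest V} (h : F ~ G) : labels F ~ labels G :=
  h.flatMap_right _

/-- The last spoke of the list `p :: F`. -/
def lastSpoke (p : V) : Forest V → V
  | [] => p
  | (_, s) :: F => lastSpoke s F

theorem lastSpoke_append (p : V) (F : Forest V) (T : BinaryTree V) (s : V) :
    lastSpoke p (F ++ [(T, s)]) = s := by
  induction F generalizing p with
  | nil => rfl
  | cons q F ih => exact ih q.2

theorem lastSpoke_mem (p : V) (F : Forest V) : lastSpoke p F ∈ p :: labels F := by
  induction F generalizing p with
  | nil => simp [lastSpoke]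
  | cons q F ih =>
    obtain ⟨T, s⟩ := q
    have := ih s
    rw [lastSpoke, labels_cons, mem_cons, mem_append]
    exact Or.inr (Or.inr this)

/-- The flip at `x` of a triangulation, up to rotation. -/
inductive Step (x : V) : Forest V → Forest V → Prop
  | rot (s : V) (F : Forest V) {T T' : BinaryTree V} (h : Rot x T T') :
      Step x ((T, s) :: F) ((T', s) :: F)
  | split (s : V) (L R : BinaryTree V) (F : Forest V) :
      Step x ((node x L R, s) :: F) ((L, x) :: (R, s) :: F)
  | merge (s : V) (L R : BinaryTree V) (F : Forest V) :
      Step x ((L, x) :: (R, s) :: F) ((node x L R, s) :: F)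

theorem Step.symm {x : V} {F G : Forest V} (h : Step x F G) : Step x G F := by
  cases h with
  | rot s F h => exact .rot s F h.symm
  | split s L R F => exact .merge s L R F
  | merge s L R F => exact .split s L R F

theorem Step.labels_perm {x : V} {F G : Forest V} (h : Step x F G) : labels F ~ labels G := by
  classical
  cases h with
  | rot s F h => simpa using h.labels_perm.append_right _
  | split s L R F | merge s L R F =>
    rw [perm_iff_count]
    intro a
    simp only [labels_cons, BinaryTree.labels, count_append, count_cons, count_nil]
    omega

/-- Two lists of trees present the same triangulation of the punctured polygon: they differ by a
rotation or, in the case of a single spoke, by an exchange of the two arcs in the self-folded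
triangle. -/
def Equiv (F G : Forest V) : Prop :=
  F ~r G ∨ ∃ r s L R, F = [(node r L R, s)] ∧ G = [(node s L R, r)]

namespace Equiv

variable {F G H : Forest V}

theorem refl (F : Forest V) : Equiv F F := Or.inl (IsRotated.refl F)

theorem symm (h : Equiv F G) : Equiv G F := by
  rcases h with h | ⟨r, s, L, R, rfl, rfl⟩
  · exact Or.inl h.symm
  · exact Or.inr ⟨s, r, L, R, rfl, rfl⟩

theorem trans (h : Equiv F G) (h' : Equiv G H) : Equiv F H := by
  rcases h with h | ⟨r, s, L, R, rfl, rfl⟩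
  · rcases h' with h' | ⟨r, s, L, R, rfl, rfl⟩
    · exact Or.inl (h.trans h')
    · exact Or.inr ⟨r, s, L, R, isRotated_singleton_iff.1 h, rfl⟩
  · rcases h' with h' | ⟨r', s', L', R', h', rfl⟩
    · rw [← isRotated_singleton_iff'.1 h']
      exact Or.inr ⟨r, s, L, R, rfl, rfl⟩
    · simp only [cons.injEq, Prod.mk.injEq, node.injEq, and_true] at h'
      obtain ⟨⟨rfl, rfl, rfl⟩, rfl⟩ := h'
      exact refl _

theorem labels_perm (h : Equiv F G) : labels F ~ labels G := by
  classical
  rcases h with h | ⟨r, s, L, R, rfl, rfl⟩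
  · exact labels_perm_of_perm h.perm
  · rw [perm_iff_count]
    intro a
    simp only [labels_cons, BinaryTree.labels, count_append, count_cons, count_nil]
    omega

end Equiv

/-- A label occurs in one entry only, so a rotation that keeps it in the head is trivial. Since a
`Step` acts on the head, this fixes the rotated presentation to which it applies. -/
theorem isRotated_cons_eq {α : Type*} {β : Type*} (f : α → List β) {p q : α} {l m : List α} {x : β}
    (h : (p :: l) ~r (q :: m)) (hp : x ∈ f p) (hq : x ∈ f q)
    (hn : ((p :: l).flatMap f).Nodup) : p :: l = q :: m := by
  obtain ⟨n, hn', h⟩ := isRotated_iff_mod.1 h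
  rw [rotate_eq_drop_append_take hn'] at h
  rcases n with _ | n
  · simpa using h
  · simp only [drop_succ_cons, take_succ_cons] at h
    rcases hd : l.drop n with _ | ⟨q', t⟩
    · rw [hd, nil_append] at h
      have hl : l.length ≤ n := by simpa using hd
      rwa [take_of_length_le hl] at h
    · rw [hd] at h
      simp only [cons_append, cons.injEq] at h
      have hq' : q ∈ l := by
        rw [← h.1]
        exact mem_of_mem_drop (hd ▸ mem_cons_self)
      rw [flatMap_cons, nodup_append] at hn
      exact absurd rfl (hn.2.2 x hp x (mem_flatMap.2 ⟨q, hq', hq⟩))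

theorem Step.mem_head {x : V} {F G : Forest V} (h : Step x F G) :
    ∃ p F', F = p :: F' ∧ x ∈ p.1.labels ++ [p.2] := by
  cases h with
  | rot s F h => exact ⟨_, _, rfl, by simp [h.mem_labels]⟩
  | split s L R F => exact ⟨_, _, rfl, by simp [BinaryTree.labels]⟩
  | merge s L R F => exact ⟨_, _, rfl, by simp⟩

theorem Step.unique_of_eq {x : V} {F G G' : Forest V} (h : Step x F G) (h' : Step x F G')
    (hF : (labels F).Nodup) : G = G' := by
  cases h with
  | rot s F h =>
    simp only [labels_cons, nodup_append] at hF
    cases h' with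
    | rot _ _ h' => rw [h.unique h' hF.1]
    | split _ L R _ => exact absurd rfl (h.root_ne hF.1)
    | merge s L R F => exact absurd rfl (hF.2.2 x h.mem_labels x (by simp))
  | split s L R F =>
    simp only [labels_cons, nodup_append] at hF
    cases h' with
    | rot _ _ h' => exact absurd rfl (h'.root_ne hF.1)
    | split _ L R _ => rfl
    | merge _ L R F => exact absurd rfl (hF.2.2 x (by simp [BinaryTree.labels]) x (by simp))
  | merge s L R F =>
    simp only [labels_cons, nodup_append] at hF
    cases h' with
    | rot _ _ h' => exact absurd rfl (hF.2.2 x h'.mem_labels x (by simp))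
    | split _ L R _ => exact absurd rfl (hF.2.2 x (by simp [BinaryTree.labels]) x (by simp))
    | merge _ L R _ => rfl

/-- For rotated forests the two presentations coincide. For an exchanged loop and spoke, a rotation
in the tree commutes with the exchange, whereas a split at `x` on both sides would make `x` loop and
spoke at once. -/
theorem Step.unique {x : V} {F F' G G' : Forest V} (h : Step x F G) (h' : Step x F' G')
    (hFF : Equiv F F') (hF : (labels F).Nodup) : Equiv G G' := by
  have hF' := hFF.labels_perm.nodup_iff.1 hF
  rcases hFF with hr | ⟨r, s, L, R, rfl, rfl⟩
  · obtain ⟨p, F, rfl, hp⟩ := h.mem_head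
    obtain ⟨q, F', rfl, hq⟩ := h'.mem_head
    have heq := isRotated_cons_eq (fun p : BinaryTree V × V => p.1.labels ++ [p.2]) hr hp hq hF
    rw [heq] at h hF
    rw [h.unique_of_eq h' hF]
    exact Equiv.refl _
  · have hT : (node r L R).labels.Nodup := by
      rw [labels_cons, nodup_append] at hF
      exact hF.1
    have hT' : (node s L R).labels.Nodup := by
      rw [labels_cons, nodup_append] at hF'
      exact hF'.1
    simp only [labels_cons, BinaryTree.labels, labels_nil] at hF hF'
    cases h with
    | rot _ _ h =>
      obtain ⟨L', R', rfl, hz⟩ := h.exists_node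
      have := h'.unique_of_eq (.rot r [] (hz s)) (by simpa [BinaryTree.labels] using hF')
      subst this
      exact Or.inr ⟨r, s, L', R', rfl, rfl⟩
    | split _ _ _ =>
      cases h' with
      | rot _ _ h' =>
        have := h'.mem_labels
        simp only [BinaryTree.labels, mem_append, mem_singleton, nodup_append] at this hF
        rcases this with h1 | rfl
        · exact absurd rfl (hF.1.2.2 x h1 x rfl)
        · exact absurd rfl (hF.2.2 x (Or.inr rfl) x rfl)
      | split _ _ _ _ => simp [nodup_append] at hF

/-- The flip at `x`. -/
def Flip (x : V) (F G : Forest V) : Prop := ∃ F' G', Equiv F F' ∧ Step x F' G' ∧ Equiv G' G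

theorem Flip.symm {x : V} {F G : Forest V} (h : Flip x F G) : Flip x G F := by
  obtain ⟨F', G', h1, h2, h3⟩ := h
  exact ⟨G', F', h3.symm, h2.symm, h1.symm⟩

theorem Flip.labels_perm {x : V} {F G : Forest V} (h : Flip x F G) : labels F ~ labels G := by
  obtain ⟨F', G', h1, h2, h3⟩ := h
  exact h1.labels_perm.trans (h2.labels_perm.trans h3.labels_perm)

theorem Flip.unique {x : V} {F F' G G' : Forest V} (h : Flip x F G) (h' : Flip x F' G')
    (hFF : Equiv F F') (hF : (labels F).Nodup) : Equiv G G' := by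
  obtain ⟨F₁, G₁, h1, h2, h3⟩ := h
  obtain ⟨F₂, G₂, h4, h5, h6⟩ := h'
  exact h3.symm.trans ((h2.unique h5 (h1.symm.trans (hFF.trans h4))
    (h1.labels_perm.nodup_iff.1 hF)).trans h6)

/-- After moving the region of `x` to the front, a root splits its region, any other node is
rotated, and a spoke merges its region with the next one. A sole spoke is first exchanged with its
loop, which exists because there are two labels. -/
theorem exists_flip {x : V} {F : Forest V} (hx : x ∈ labels F) (hF : 2 ≤ (labels F).length) :
    ∃ G, Flip x F G := by
  obtain ⟨⟨T, s⟩, hmem, hx'⟩ := mem_flatMap.1 hx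
  obtain ⟨F₁, F₂, rfl⟩ := append_of_mem hmem
  have hr : (F₁ ++ (T, s) :: F₂) ~r ((T, s) :: (F₂ ++ F₁)) := isRotated_append
  have h0 : Equiv (F₁ ++ (T, s) :: F₂) ((T, s) :: (F₂ ++ F₁)) := Or.inl hr
  rw [h0.labels_perm.length_eq] at hF
  replace hx : x ∈ T.labels ∨ x = s := by simpa using hx'
  suffices h : ∃ G, Flip x ((T, s) :: (F₂ ++ F₁)) G by
    obtain ⟨G, F', G', h1, h2, h3⟩ := h
    exact ⟨G, F', G', h0.trans h1, h2, h3⟩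
  rcases hx with hx | rfl
  · rcases Rot.exists_of_mem hx with ⟨L, R, rfl⟩ | ⟨T', hT'⟩
    · exact ⟨_, _, _, Equiv.refl _, .split _ _ _ _, Equiv.refl _⟩
    · exact ⟨_, _, _, Equiv.refl _, .rot _ _ hT', Equiv.refl _⟩
  · rcases hU : F₂ ++ F₁ with _ | ⟨⟨R, s⟩, F⟩
    · rw [hU] at hF
      rcases T with _ | ⟨r, L, R⟩
      · simp [BinaryTree.labels] at hF
      · exact ⟨_, _, _, Or.inr ⟨r, x, L, R, rfl, rfl⟩, .split _ _ _ _, Equiv.refl _⟩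
    · exact ⟨_, _, _, Equiv.refl _, .merge _ _ _ _, Equiv.refl _⟩

/-! ### The matrix of a triangulation; flips are mutations. -/

variable [DecidableEq V]

/-- The sum of the triangles of the regions in a list, which is preceded by the spoke `p`. -/
def wheel (p : V) : Forest V → V → V → ℤ
  | [] => 0
  | (T, s) :: F => tri (pt s) (pt p) T.topInd + T.mat + wheel s F

/-- The skew-symmetric matrix of a triangulation of the punctured polygon. -/
def mat : Forest V → V → V → ℤ
  | [] => 0
  | [(T, s)] => T.fatMat (T.topInd + pt s)
  | p :: q :: F => wheel (lastSpoke p.2 (q :: F)) (p :: q :: F)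

theorem wheel_append (p : V) (F G : Forest V) :
    wheel p (F ++ G) = wheel p F + wheel (lastSpoke p F) G := by
  induction F generalizing p with
  | nil => simp [wheel, lastSpoke]
  | cons q F ih => simp [wheel, lastSpoke, ih, add_assoc]

theorem wheel_eq_zero {p i : V} {F : Forest V} (hp : i ≠ p) (hF : i ∉ labels F) (j : V) :
    wheel p F i j = 0 ∧ wheel p F j i = 0 := by
  induction F generalizing p with
  | nil => exact ⟨rfl, rfl⟩
  | cons q F ih =>
    obtain ⟨T, s⟩ := q
    simp only [labels_cons, mem_append, mem_cons, not_or] at hF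
    simp [wheel, tri_apply, pt_of_ne hp, pt_of_ne hF.2.1, topInd_eq_zero hF.1,
      mat_eq_zero hF.1, ih hF.2.1 hF.2.2]

theorem mat_concat (T : BinaryTree V) (s : V) (F : Forest V) :
    mat (F ++ [(T, s)]) = mat ((T, s) :: F) := by
  rcases F with _ | ⟨q, F⟩
  · rfl
  · have h : mat (q :: F ++ [(T, s)]) = wheel s (q :: F ++ [(T, s)]) := by
      rw [cons_append]
      rcases hG : F ++ [(T, s)] with _ | ⟨q', G⟩
      · simp at hG
      · rw [mat, ← hG, lastSpoke_append]
    rw [h, wheel_append, mat]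
    simp only [wheel, lastSpoke, add_zero]
    abel

theorem mat_eq_of_isRotated {F G : Forest V} (h : F ~r G) : mat F = mat G := by
  obtain ⟨n, rfl⟩ := h
  induction n with
  | zero => simp
  | succ n ih =>
    rw [ih, ← rotate_rotate]
    rcases F.rotate n with _ | ⟨⟨T, s⟩, G⟩
    · rfl
    · simp [mat_concat]

theorem Equiv.mat_eq {F G : Forest V} (h : Equiv F G) : mat F = mat G := by
  rcases h with h | ⟨r, s, L, R, rfl, rfl⟩
  · exact mat_eq_of_isRotated h
  · simp only [mat, fatMat, topInd_node, add_comm]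

/-- The spoke `x` is a diagonal of the quadrilateral bounded by the neighbouring spokes and the root
edges of `L` and `R`. -/
theorem isFlip_merge {x s : V} {L R : BinaryTree V} {F : Forest V}
    (hF : (labels ((L, x) :: (R, s) :: F)).Nodup) :
    IsFlip x (mat ((L, x) :: (R, s) :: F)) (mat ((node x L R, s) :: F)) := by
  simp only [labels_cons, nodup_append, nodup_cons, mem_append, mem_cons, not_or] at hF
  obtain ⟨-, ⟨⟨hxR, hxs, hxF⟩, -, ⟨hsF, -⟩, hR⟩, hL⟩ := hF
  have hxL : x ∉ L.labels := fun h => hL x h x (Or.inl rfl) rfl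
  have hsL : s ∉ L.labels := fun h => hL s h s (by simp) rfl
  have hsR : s ∉ R.labels := fun h => hR s h s (by simp) rfl
  have hLR (i : V) (h : i ∈ L.labels) : i ∉ R.labels := fun h' => hL i h i (by simp [h']) rfl
  rcases F with _ | ⟨⟨U, t⟩, F⟩
  -- With only two spokes, both neighbours of `x` are `s`, and the arrows between `x` and `s`
  -- cancel. So two sides are taken to be `0`, and the arrows between `s` and the root edges go into
  -- the remainder.
  · refine ⟨0, L.topInd, R.topInd, 0,
      wedge (pt s) L.topInd + wedge R.topInd (pt s) + L.mat + R.mat,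
      ⟨fun _ => le_rfl, topInd_nonneg L, topInd_nonneg R, fun _ => le_rfl⟩,
      ⟨rfl, topInd_eq_zero hxL, topInd_eq_zero hxR, rfl⟩, fun i => ?_, fun j => ?_, ?_, ?_⟩
    · by_cases h : i ∈ L.labels
      · simp [topInd_eq_zero (hLR i h)]
      · simp [topInd_eq_zero h]
    · simp [wedge, pt_of_ne hxs, topInd_eq_zero hxL, topInd_eq_zero hxR, mat_eq_zero hxL,
        mat_eq_zero hxR]
    · funext i j
      simp only [mat, lastSpoke, wheel, Pi.add_apply, tri_apply, wedge, Pi.zero_apply]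
      ring
    · funext i j
      simp only [mat, fatMat, topInd_node, Pi.add_apply, tri_apply, wedge, Pi.zero_apply]
      ring
  · set p := lastSpoke t F with hp
    have hpF : p ∈ labels ((U, t) :: F) := by
      rw [labels_cons]
      exact mem_append_right _ (lastSpoke_mem t F)
    have hpx : x ≠ p := fun h => hxF (h ▸ hpF)
    have hps : s ≠ p := fun h => hsF (h ▸ hpF)
    have hpL : p ∉ L.labels := fun h => hL p h p (Or.inr (Or.inr (Or.inr hpF))) rfl
    have hpR : p ∉ R.labels := fun h => hR p h p (Or.inr hpF) rfl
    refine ⟨pt p, L.topInd, R.topInd, pt s, L.mat + R.mat + wheel s ((U, t) :: F),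
      ⟨pt_nonneg p, topInd_nonneg L, topInd_nonneg R, pt_nonneg s⟩,
      ⟨pt_of_ne hpx, topInd_eq_zero hxL, topInd_eq_zero hxR, pt_of_ne hxs⟩,
      fun i => ?_, fun j => ?_, ?_, ?_⟩
    · by_cases h : i ∈ L.labels
      · rw [topInd_eq_zero (hLR i h), pt_of_ne (x := p) (by rintro rfl; exact hpL h)]
        simp
      · by_cases h' : i = s
        · subst h'
          rw [topInd_eq_zero hsR, pt_of_ne hps]
          simp
        · rw [topInd_eq_zero h, pt_of_ne h']
          simp
    · simp [mat_eq_zero hxL, mat_eq_zero hxR, wheel_eq_zero hxs hxF]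
    · funext i j
      simp only [mat, lastSpoke, ← hp, wheel, Pi.add_apply, tri_apply]
      ring
    · funext i j
      simp only [mat, lastSpoke, ← hp, wheel, BinaryTree.mat, topInd_node, Pi.add_apply, tri_apply]
      ring

theorem Step.isFlip {x : V} {F G : Forest V} (h : Step x F G) (hF : (labels F).Nodup) :
    IsFlip x (mat F) (mat G) := by
  cases h with
  | rot s F h =>
    rename_i T T'
    simp only [labels_cons, nodup_append, nodup_cons, mem_cons] at hF
    obtain ⟨hT, ⟨hsF, -⟩, hTF⟩ := hF
    have hsT : s ∉ T.labels := fun h => hTF s h s (by simp) rfl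
    rcases F with _ | ⟨⟨U, t⟩, F⟩
    · simp only [mat, ← h.topInd_eq]
      refine h.isFlip hT (fun i => add_nonneg (topInd_nonneg T i) (pt_nonneg s i))
        fun i hi h0 => ?_
      rw [Pi.add_apply, h0, pt_of_ne (by rintro rfl; exact hsT hi), add_zero]
    · have h1 := h.isFlip hT (topInd_nonneg T) (fun i _ h => h)
      rw [← mat_eq_fatMat, h.topInd_eq, ← mat_eq_fatMat] at h1
      have hx := h.mem_labels
      have hxF : x ∉ labels ((U, t) :: F) := fun h => hTF x hx x (Or.inr h) rfl
      have hxs : x ≠ s := by rintro rfl; exact hsT hx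
      have hxp : x ≠ lastSpoke t F := by
        intro h
        apply hxF
        rw [h, labels_cons]
        exact mem_append_right _ (lastSpoke_mem t F)
      have h2 := h1.add (S := tri (pt s) (pt (lastSpoke t F)) T.topInd + wheel s ((U, t) :: F))
        (fun j => by
          simp [tri_apply, pt_of_ne hxs, pt_of_ne hxp, h.topInd_self hT, wheel_eq_zero hxs hxF])
      have h3 (T : BinaryTree V) : mat ((T, s) :: (U, t) :: F) =
          T.mat + (tri (pt s) (pt (lastSpoke t F)) T.topInd + wheel s ((U, t) :: F)) := by
        rw [mat, wheel, lastSpoke]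
        abel
      rw [h3, h3, ← h.topInd_eq]
      exact h2
  | merge s L R F => exact isFlip_merge hF
  | split s L R F => exact (isFlip_merge ((Step.split s L R F).labels_perm.nodup_iff.1 hF)).symm

theorem Flip.skew_mutate {x : V} {F G : Forest V} (h : Flip x F G) (hF : (labels F).Nodup)
    {Q : ClusterQuiver V} (hQ : Q.skew = mat F) : (Q.mutate x).skew = mat G := by
  obtain ⟨F', G', h1, h2, h3⟩ := h
  rw [← h3.mat_eq]
  exact (h2.isFlip (h1.labels_perm.nodup_iff.1 hF)).skew_mutate (hQ.trans h1.mat_eq)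

end Forest

end ClusterQuiver

/-! ### Relabelling, connectedness under flips, and transport of rigidity. -/

namespace BinaryTree

open ClusterQuiver

variable {α β V : Type*}

theorem labels_map (f : α → β) (T : BinaryTree α) : (T.map f).labels = T.labels.map f := by
  induction T with
  | nil => rfl
  | node a l r hl hr => simp [BinaryTree.map, labels, hl, hr]

theorem Rot.map (f : α → β) {x : α} {T T' : BinaryTree α} (h : Rot x T T') :
    Rot (f x) (T.map f) (T'.map f) := by
  induction h with
  | right y A B C => exact .right _ _ _ _
  | left y A B C => exact .left _ _ _ _
  | congr_left y R _ ih => exact .congr_left _ _ ih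
  | congr_right y L _ ih => exact .congr_right _ _ ih

/-- The tree without left children with the given labels. -/
def comb : List α → BinaryTree α
  | [] => nil
  | v :: vs => node v nil (comb vs)

theorem map_comb (f : α → β) (vs : List α) : (comb vs).map f = comb (vs.map f) := by
  induction vs with
  | nil => rfl
  | cons v vs ih => simp [comb, BinaryTree.map, ih]

theorem labels_comb (vs : List α) : (comb vs).labels = vs.reverse := by
  induction vs with
  | nil => rfl
  | cons v vs ih => simp [comb, labels, ih]

open Relation in
-- A right rotation at the left child of the root shrinks the left subtree; once it is empty, the
-- argument continues in the right subtree.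
theorem exists_reflTransGen_comb (T : BinaryTree α) :
    ∃ vs, ReflTransGen (fun T T' : BinaryTree α => ∃ x, Rot x T T') T (comb vs) := by
  suffices h : ∀ (n : ℕ) (T : BinaryTree α), T.numNodes ≤ n →
      ∃ vs, ReflTransGen (fun T T' : BinaryTree α => ∃ x, Rot x T T') T (comb vs) from
    h _ T le_rfl
  intro n
  induction n with
  | zero =>
    rintro (_ | ⟨a, l, r⟩) hT
    · exact ⟨[], .refl⟩
    · simp [numNodes] at hT
  | succ n ih =>
    rintro (_ | ⟨a, l, r⟩) hT
    · exact ⟨[], .refl⟩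
    · induction l generalizing r with
      | nil =>
        obtain ⟨vs, hvs⟩ := ih r (by simp [numNodes] at hT; omega)
        exact ⟨a :: vs, hvs.lift (node a nil) fun _ _ ⟨x, hx⟩ => ⟨x, .congr_right _ _ hx⟩⟩
      | node b A B ihA _ =>
        obtain ⟨vs, hvs⟩ := ihA (node b B r) (by simp [numNodes] at hT ⊢; omega)
        exact ⟨vs, .head ⟨b, .right _ _ _ _⟩ hvs⟩

theorem topInd_map [DecidableEq V] (σ : Equiv.Perm V) (T : BinaryTree V) (i : V) :
    (T.map σ).topInd (σ i) = T.topInd i := by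
  cases T with
  | nil => rfl
  | node a l r => simp [BinaryTree.map, pt_apply]

theorem mat_map [DecidableEq V] (σ : Equiv.Perm V) (T : BinaryTree V) (i j : V) :
    (T.map σ).mat (σ i) (σ j) = T.mat i j := by
  induction T with
  | nil => rfl
  | node a l r hl hr =>
    simp [BinaryTree.map, mat, tri_apply, topInd_map, hl, hr, pt_apply]

end BinaryTree

namespace ClusterQuiver

open BinaryTree List Relation

variable {V : Type*}

theorem exists_perm_map_eq {α : Type*} [DecidableEq α] {l m : List α} (hl : l.Nodup) (hm : m.Nodup)
    (hl' : ∀ a, a ∈ l) (hm' : ∀ a, a ∈ m) : ∃ σ : Equiv.Perm α, l.map σ = m := by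
  have hlen : l.length = m.length :=
    ((perm_ext_iff_of_nodup hl hm).2 fun a => by simp [hl', hm']).length_eq
  let e := hl.getEquivOfForallMemList l hl'
  let f := hm.getEquivOfForallMemList m hm'
  refine ⟨(e.symm.trans (finCongr hlen)).trans f, ?_⟩
  apply ext_getElem (by simp [hlen])
  intro i h1 h2
  have h3 : i < l.length := by simpa using h1
  have : e.symm l[i] = ⟨i, h3⟩ := by
    rw [Equiv.symm_apply_eq]
    rfl
  simp only [getElem_map, Equiv.trans_apply, this]
  rfl

namespace Forest

/-- Relabelling a forest. -/
def relabel {α β : Type*} (f : α → β) (F : Forest α) : Forest β :=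
  F.map fun p => (p.1.map f, f p.2)

theorem labels_relabel {α β : Type*} (f : α → β) (F : Forest α) :
    labels (relabel f F) = (labels F).map f := by
  induction F with
  | nil => rfl
  | cons p F ih =>
    obtain ⟨T, s⟩ := p
    simp only [relabel, map_cons, labels_cons, BinaryTree.labels_map, map_append] at ih ⊢
    rw [ih]

theorem Step.relabel {x : V} {F G : Forest V} (f : V → V) (h : Step x F G) :
    Step (f x) (relabel f F) (relabel f G) := by
  cases h with
  | rot s F h => exact .rot _ _ (h.map f)
  | split s L R F => exact .split _ _ _ _
  | merge s L R F => exact .merge _ _ _ _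

theorem Equiv.relabel {F G : Forest V} (f : V → V) (h : Equiv F G) :
    Equiv (relabel f F) (relabel f G) := by
  rcases h with h | ⟨r, s, L, R, rfl, rfl⟩
  · exact Or.inl (h.map _)
  · exact Or.inr ⟨f r, f s, L.map f, R.map f, rfl, rfl⟩

theorem Flip.relabel {x : V} {F G : Forest V} (f : V → V) (h : Flip x F G) :
    Flip (f x) (relabel f F) (relabel f G) := by
  obtain ⟨F', G', h1, h2, h3⟩ := h
  exact ⟨_, _, h1.relabel f, h2.relabel f, h3.relabel f⟩

/-- Two forests are connected by flips. -/
def Reach : Forest V → Forest V → Prop := ReflTransGen fun F G => ∃ x, Flip x F G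

theorem Reach.symm {F G : Forest V} (h : Reach F G) : Reach G F :=
  ReflTransGen.lift id (fun _ _ ⟨x, hx⟩ => ⟨x, Flip.symm hx⟩) _ _ (reflTransGen_swap.2 h)

theorem Reach.relabel {F G : Forest V} (f : V → V) (h : Reach F G) :
    Reach (relabel f F) (relabel f G) :=
  h.lift _ fun _ _ ⟨x, hx⟩ => ⟨f x, hx.relabel f⟩

theorem Reach.labels_perm {F G : Forest V} (h : Reach F G) : labels F ~ labels G := by
  induction h with
  | refl => exact Perm.refl _
  | tail _ h ih => exact ih.trans h.choose_spec.labels_perm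

theorem Step.reach {x : V} {F G : Forest V} (h : Step x F G) : Reach F G :=
  .single ⟨x, F, G, Equiv.refl _, h, Equiv.refl _⟩

/-- Merging removes the spokes one by one; the tree of the last spoke is then straightened. -/
theorem exists_reach_comb (F : Forest V) (T : BinaryTree V) (s : V) :
    ∃ vs t, Reach ((T, s) :: F) [(comb vs, t)] := by
  induction F generalizing T s with
  | nil =>
    obtain ⟨vs, hvs⟩ := exists_reflTransGen_comb T
    exact ⟨vs, s, hvs.lift (fun T => [(T, s)]) fun _ _ ⟨x, hx⟩ =>
      ⟨x, _, _, Equiv.refl _, .rot s [] hx, Equiv.refl _⟩⟩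
  | cons p F ih =>
    obtain ⟨R, t⟩ := p
    obtain ⟨vs, u, h⟩ := ih (node s T R) t
    exact ⟨vs, u, (Step.merge t T R F).reach.trans h⟩

/-- Every vertex occurs exactly once as a label. -/
def Valid (F : Forest V) : Prop := (labels F).Nodup ∧ ∀ v, v ∈ labels F

theorem Valid.of_perm {F G : Forest V} (hF : Valid F) (h : labels F ~ labels G) : Valid G :=
  ⟨h.nodup_iff.1 hF.1, fun v => h.mem_iff.1 (hF.2 v)⟩

theorem Valid.relabel {F : Forest V} (hF : Valid F) (σ : Equiv.Perm V) : Valid (relabel σ F) := by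
  refine ⟨?_, fun v => ?_⟩
  · rw [labels_relabel]
    exact hF.1.map σ.injective
  · rw [labels_relabel]
    exact mem_map.2 ⟨σ.symm v, hF.2 _, by simp⟩

theorem Valid.length_eq {n : ℕ} {F : Forest V} (hF : Valid F) (e : V ≃ Fin n) :
    (labels F).length = n := by
  classical
  have := Fintype.ofEquiv _ e.symm
  have h := List.toFinset_card_of_nodup hF.1
  have h' : (labels F).toFinset = Finset.univ := by
    ext v; simp [hF.2 v]
  rw [← h, h', Finset.card_univ, Fintype.card_congr e, Fintype.card_fin]

/-- Both forests flip to one-spoke combs, and two such combs on all of `V` differ by a permutation.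
Connectedness up to relabelling is enough, as quivers are counted up to isomorphism. -/
theorem exists_reach_relabel [DecidableEq V] {F G : Forest V} (hF : Valid F) (hG : Valid G)
    (hF0 : F ≠ []) (hG0 : G ≠ []) : ∃ σ : Equiv.Perm V, Reach F (Forest.relabel σ G) := by
  obtain ⟨⟨T, s⟩, F, rfl⟩ := exists_cons_of_ne_nil hF0
  obtain ⟨⟨U, t⟩, G, rfl⟩ := exists_cons_of_ne_nil hG0
  obtain ⟨vs, s', h⟩ := exists_reach_comb F T s
  obtain ⟨ws, t', h'⟩ := exists_reach_comb G U t
  have hl := hF.of_perm h.labels_perm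
  have hm := hG.of_perm h'.labels_perm
  obtain ⟨σ, hσ⟩ := exists_perm_map_eq hm.1 hl.1 hm.2 hl.2
  simp only [labels_cons, labels_comb, labels_nil, map_append, map_cons, map_nil] at hσ
  rw [map_reverse] at hσ
  obtain ⟨h1, h2⟩ := append_inj' hσ rfl
  refine ⟨σ, h.trans (Reach.symm ?_)⟩
  have := h'.relabel σ
  simp only [Forest.relabel, map_cons, map_nil, map_comb] at this ⊢
  rw [reverse_injective h1, (cons.inj h2).1] at this
  exact this

theorem lastSpoke_relabel (f : V → V) (p : V) (F : Forest V) :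
    lastSpoke (f p) (relabel f F) = f (lastSpoke p F) := by
  induction F generalizing p with
  | nil => rfl
  | cons q F ih => exact ih q.2

variable [DecidableEq V]

theorem wheel_relabel (σ : Equiv.Perm V) (p : V) (F : Forest V) (i j : V) :
    wheel (σ p) (relabel σ F) (σ i) (σ j) = wheel p F i j := by
  induction F generalizing p with
  | nil => rfl
  | cons q F ih =>
    have := ih q.2
    simp only [Forest.relabel, map_cons, wheel, Pi.add_apply, tri_apply, topInd_map,
      BinaryTree.mat_map] at this ⊢
    rw [this]
    simp [pt_apply]

theorem mat_relabel (σ : Equiv.Perm V) (F : Forest V) (i j : V) :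
    mat (relabel σ F) (σ i) (σ j) = mat F i j := by
  rcases F with _ | ⟨⟨T, s⟩, _ | ⟨q, F⟩⟩
  · rfl
  · rcases T with _ | ⟨a, l, r⟩
    · rfl
    · simp [Forest.relabel, mat, BinaryTree.map, fatMat, tri_apply, topInd_map,
        BinaryTree.mat_map, pt_apply]
  · have h := lastSpoke_relabel σ s (q :: F)
    have h' := wheel_relabel σ (lastSpoke s (q :: F)) ((T, s) :: q :: F) i j
    rw [← h] at h'
    exact h'

theorem Reach.exists_skew_eq {F G : Forest V} (h : Reach F G) (hF : (labels F).Nodup)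
    {Q : ClusterQuiver V} (hQ : Q.skew = mat F) : ∃ Q', Q.MutationEquiv Q' ∧ Q'.skew = mat G := by
  induction h with
  | refl => exact ⟨Q, .refl, hQ⟩
  | tail h1 h2 ih =>
    obtain ⟨Q', h3, h4⟩ := ih
    obtain ⟨x, hx⟩ := h2
    exact ⟨Q'.mutate x, h3.tail ⟨x, rfl⟩,
      hx.skew_mutate ((Reach.labels_perm h1).nodup_iff.1 hF) h4⟩

theorem exists_skew_eq_of_mutationEquiv {F : Forest V} (hF : Valid F)
    (hF2 : 2 ≤ (labels F).length) {Q Q' : ClusterQuiver V} (hQ : Q.skew = mat F)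
    (h : Q.MutationEquiv Q') : ∃ G, Valid G ∧ G ≠ [] ∧ Q'.skew = mat G := by
  have hne {G : Forest V} (h : labels F ~ labels G) : G ≠ [] := by
    rintro rfl
    simp [h.length_eq] at hF2
  suffices h : ∃ G, labels F ~ labels G ∧ Q'.skew = mat G by
    obtain ⟨G, h1, h2⟩ := h
    exact ⟨G, hF.of_perm h1, hne h1, h2⟩
  induction h with
  | refl => exact ⟨F, Perm.refl _, hQ⟩
  | tail _ h ih =>
    obtain ⟨G, h1, h2⟩ := ih
    obtain ⟨x, rfl⟩ := h
    obtain ⟨G', hG'⟩ := exists_flip (h1.mem_iff.1 (hF.2 x)) (h1.length_eq ▸ hF2)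
    exact ⟨G', h1.trans hG'.labels_perm, hG'.skew_mutate (h1.nodup_iff.1 hF.1) h2⟩

end Forest

open Forest

theorem MutationEquiv.symm [DecidableEq V] {Q Q' : ClusterQuiver V} (h : Q.MutationEquiv Q') :
    Q'.MutationEquiv Q :=
  ReflTransGen.lift id (fun _ _ ⟨k, hk⟩ => ⟨k, by rw [id, id, hk, mutate_mutate]⟩)
    _ _ (reflTransGen_swap.2 h)

/-- A quiver determines the triangulation which it comes from. -/
def Rigid [DecidableEq V] (Q : ClusterQuiver V) : Prop :=
  ∀ F G : Forest V, Valid F → Valid G → Q.skew = mat F → Q.skew = mat G → Forest.Equiv F G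

/-- Two forests of the mutated quiver are flipped back at `x`. Rigidity before the mutation
identifies the results, and uniqueness of flips then identifies the forests themselves. -/
theorem Rigid.of_mutationEquiv [DecidableEq V] {n : ℕ} (e : V ≃ Fin n) (hn : 2 ≤ n)
    {Q Q' : ClusterQuiver V} (hQ : Q.Rigid) (h : Q.MutationEquiv Q') : Q'.Rigid := by
  induction h with
  | refl => exact hQ
  | tail _ h ih =>
    obtain ⟨x, rfl⟩ := h
    rename_i Q' _ _
    intro F G hF hG hQF hQG
    obtain ⟨F', hF'⟩ := exists_flip (hF.2 x) ((hF.length_eq e).symm ▸ hn)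
    obtain ⟨G', hG'⟩ := exists_flip (hG.2 x) ((hG.length_eq e).symm ▸ hn)
    have h1 := hF'.skew_mutate hF.1 hQF
    have h2 := hG'.skew_mutate hG.1 hQG
    rw [mutate_mutate] at h1 h2
    have h3 := ih F' G' (hF.of_perm hF'.labels_perm) (hG.of_perm hG'.labels_perm) h1 h2
    exact hF'.symm.unique hG'.symm h3 (hF'.labels_perm.nodup_iff.1 hF.1)

end ClusterQuiver

/-! ### Rigidity of the linear orientation of D_n. -/

namespace BinaryTree

open ClusterQuiver List

variable {V : Type*}

theorem tri_zero_left (a b : V → ℤ) : tri a 0 b = wedge b a := by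
  funext i j; simp only [tri_apply, wedge, Pi.zero_apply]; ring

variable [DecidableEq V]

theorem topInd_comb_cons (v : V) (l : List V) : (comb (v :: l)).topInd = pt v := rfl

theorem mat_comb_cons (v : V) (l : List V) :
    (comb (v :: l)).mat = wedge (comb l).topInd (pt v) + (comb l).mat := by
  rw [comb, mat]
  have : (nil : BinaryTree V).topInd = 0 := rfl
  rw [this, tri_zero_left]
  simp [mat]

/-- Without left children each triangle degenerates to a single arrow from a node to its parent, so
the comb gives a linearly oriented chain. -/
theorem mem_of_mat_comb_pos {l : List V} (hl : l.Nodup) {i j : V} (h : 0 < (comb l).mat i j) :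
    i ∈ l ∧ j ∈ l ∧ l.idxOf i = l.idxOf j + 1 := by
  induction l with
  | nil => simp [comb, mat] at h
  | cons a l ih =>
    rw [nodup_cons] at hl
    rw [mat_comb_cons, Pi.add_apply, Pi.add_apply] at h
    by_cases h' : 0 < (comb l).mat i j
    · obtain ⟨h1, h2, h3⟩ := ih hl.2 h'
      have h4 : a ≠ i := by rintro rfl; exact hl.1 h1
      have h5 : a ≠ j := by rintro rfl; exact hl.1 h2
      refine ⟨mem_cons_of_mem _ h1, mem_cons_of_mem _ h2, ?_⟩
      rw [idxOf_cons_ne _ h4, idxOf_cons_ne _ h5, h3]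
    · have h1 : 0 < wedge (comb l).topInd (pt a) i j := by omega
      rcases l with _ | ⟨b, l⟩
      · simp [wedge, comb, topInd] at h1
      · simp only [wedge, comb, topInd_node, pt_apply] at h1
        have hij : i = b ∧ j = a := by
          split_ifs at h1 <;> simp_all
        obtain ⟨rfl, rfl⟩ := hij
        have hne : j ≠ i := by rintro rfl; exact hl.1 mem_cons_self
        refine ⟨by simp, by simp, ?_⟩
        rw [idxOf_cons_ne _ hne]
        simp

/-- The tree is recovered from the root downwards. A left child would receive an arrow from the
root, which is a sink in the comb; the arrows into the root then give the root of the right subtree.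
-/
theorem eq_comb_of_mat_eq {l : List V} {T : BinaryTree V} (hl : l.Nodup) (hT : T.labels ~ l)
    (hmat : T.mat = (comb l).mat) (htop : T.topInd = (comb l).topInd) : T = comb l := by
  induction l generalizing T with
  | nil =>
    rcases T with _ | ⟨a, L, R⟩
    · rfl
    · simp [labels] at hT
  | cons v l ih =>
    rcases T with _ | ⟨a, L, R⟩
    · simp [labels] at hT
    · have hav : a = v := by
        have := congrFun htop v
        simp only [comb, topInd_node, pt_self, pt_apply] at this
        by_contra h
        simp [Ne.symm h] at this
      subst hav
      have hTn := hT.nodup_iff.2 hl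
      obtain ⟨h1, h2, h3, h4, h5⟩ := Rot.not_mem_of_nodup hTn
      have hL : L = nil := by
        rcases L with _ | ⟨c, A, B⟩
        · rfl
        · exfalso
          have hc : c ∉ R.labels := h5 c (by simp [labels])
          have hac : c ≠ a := by rintro rfl; exact h3 (by simp [labels])
          have hpos : 0 < (comb (a :: l)).mat a c := by
            rw [← hmat, mat]
            simp [tri_apply, pt_of_ne hac, topInd_eq_zero hc, topInd_eq_zero h4,
              mat_eq_zero h3, mat_eq_zero h4]
          have := (mem_of_mat_comb_pos hl hpos).2.2
          simp at this
      subst hL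
      have hR : R.labels ~ l := by
        simp only [labels, nil_append] at hT
        exact (perm_cons a).1 ((perm_append_singleton a _).symm.trans hT)
      have hal : a ∉ (comb l).labels := by
        rw [labels_comb, mem_reverse]
        exact (nodup_cons.1 hl).1
      have hm : (node a nil R).mat = wedge R.topInd (pt a) + R.mat := by
        have : (nil : BinaryTree V).topInd = 0 := rfl
        rw [mat, this, tri_zero_left]
        simp [mat]
      rw [hm, mat_comb_cons] at hmat
      have htop' : R.topInd = (comb l).topInd := by
        funext i
        have := congrFun (congrFun hmat i) a
        simpa [wedge, topInd_eq_zero h4, topInd_eq_zero hal, mat_eq_zero h4, mat_eq_zero hal]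
          using this
      rw [htop'] at hmat
      rw [comb, ih (nodup_cons.1 hl).2 hR (add_left_cancel hmat) htop']

end BinaryTree

namespace ClusterQuiver

open BinaryTree List

variable {V : Type*} [DecidableEq V]

namespace Forest

/-- With at least three spokes, two consecutive ones share exactly one triangle, so nothing cancels
and the spokes form an oriented cycle. -/
theorem mat_spoke_spoke {T U : BinaryTree V} {s t : V} {p : BinaryTree V × V} {F : Forest V}
    (hF : (labels ((T, s) :: (U, t) :: p :: F)).Nodup) :
    mat ((T, s) :: (U, t) :: p :: F) t s = 1 := by
  obtain ⟨W, u⟩ := p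
  have hl : lastSpoke u F ∈ labels ((W, u) :: F) := by
    rw [labels_cons]
    exact mem_append_right _ (lastSpoke_mem u F)
  rw [labels_cons, labels_cons] at hF
  simp only [mat, lastSpoke]
  rw [wheel, wheel]
  set q := lastSpoke u F
  simp only [nodup_append, nodup_cons, mem_append, mem_cons, not_or] at hF
  obtain ⟨-, ⟨⟨hsU, hst, hsF⟩, -, ⟨htF, -⟩, hU⟩, hT⟩ := hF
  have htT : t ∉ T.labels := fun h => hT t h t (by simp) rfl
  have hsT : s ∉ T.labels := fun h => hT s h s (by simp) rfl
  have htU : t ∉ U.labels := fun h => hU t h t (by simp) rfl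
  have hqt : t ≠ q := by rintro h; exact htF (h ▸ hl)
  simp [tri_apply, topInd_eq_zero htT, topInd_eq_zero htU, topInd_eq_zero hsU, pt_of_ne hqt,
    mat_eq_zero htT, mat_eq_zero htU, wheel_eq_zero hst hsF, pt_of_ne hst, pt_of_ne (Ne.symm hst)]

/-- If there were three spokes, one maximising `f` would receive an arrow from the next spoke, where
`f` would be larger. -/
theorem length_le_two {G : Forest V} (hG : (labels G).Nodup) (f : V → ℕ)
    (hf : ∀ i j, 0 < mat G i j → f j < f i) : G.length ≤ 2 := by
  by_contra! hlen
  obtain ⟨p, hp, hmax⟩ : ∃ p ∈ G, ∀ q ∈ G, f q.2 ≤ f p.2 := by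
    have hne : G.toFinset.Nonempty := by
      rw [List.toFinset_nonempty_iff]
      rintro rfl
      simp at hlen
    obtain ⟨p, hp, h⟩ := G.toFinset.exists_max_image (fun p => f p.2) hne
    exact ⟨p, List.mem_toFinset.1 hp, fun q hq => h q (List.mem_toFinset.2 hq)⟩
  obtain ⟨F₁, F₂, rfl⟩ := append_of_mem hp
  have hr : (F₁ ++ p :: F₂) ~r (p :: (F₂ ++ F₁)) := isRotated_append
  rcases hH : F₂ ++ F₁ with _ | ⟨⟨U, t⟩, _ | ⟨r, F⟩⟩
  · rw [hr.perm.length_eq, hH] at hlen; simp at hlen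
  · rw [hr.perm.length_eq, hH] at hlen; simp at hlen
  · obtain ⟨T, s⟩ := p
    rw [hH] at hr
    have h1 := mat_spoke_spoke ((labels_perm_of_perm hr.perm).nodup_iff.1 hG)
    rw [← mat_eq_of_isRotated hr] at h1
    have h2 := hf t s (by omega)
    have h3 := hmax (U, t) (hr.perm.mem_iff.2 (by simp))
    simp only at h3
    omega

/-- The two roots and the two spokes form an oriented cycle `t → a → s → b → t`, along which `f`
cannot decrease. -/
theorem not_node_node {a b s t : V} {L R L' R' : BinaryTree V}
    (hG : (labels [(node a L R, s), (node b L' R', t)]).Nodup) (f : V → ℕ)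
    (hf : ∀ i j, 0 < mat [(node a L R, s), (node b L' R', t)] i j → f j < f i) : False := by
  have key {a b s t : V} {L R L' R' : BinaryTree V}
      (hG : (labels [(node a L R, s), (node b L' R', t)]).Nodup) :
      mat [(node a L R, s), (node b L' R', t)] t a = 1 ∧
      mat [(node a L R, s), (node b L' R', t)] a s = 1 := by
    simp only [labels_cons, labels_nil, nodup_append, nodup_cons, mem_append, mem_cons,
      not_or] at hG
    obtain ⟨-, ⟨⟨hsU, hst, -⟩, -, -, hU⟩, hT⟩ := hG
    have htT : t ∉ (node a L R).labels := fun h => hT t h t (by simp) rfl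
    have hsT : s ∉ (node a L R).labels := fun h => hT s h s (by simp) rfl
    have htU : t ∉ (node b L' R').labels := fun h => hU t h t (by simp) rfl
    have haT : a ∈ (node a L R).labels := by simp [BinaryTree.labels]
    have haU : a ∉ (node b L' R').labels := fun h => hT a haT a (by simp [h]) rfl
    have hbU : b ∈ (node b L' R').labels := by simp [BinaryTree.labels]
    have hab : a ≠ b := by rintro rfl; exact haU hbU
    have hsa : a ≠ s := by rintro rfl; exact hsT haT
    have hta : a ≠ t := by rintro rfl; exact htT haT
    have hsb : s ≠ b := by rintro rfl; exact hsU hbU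
    have htb : t ≠ b := by rintro rfl; exact htU hbU
    simp only [mat, lastSpoke, wheel, topInd_node, Pi.add_apply, tri_apply, mat_eq_zero htT,
      mat_eq_zero htU, mat_eq_zero hsT, mat_eq_zero hsU, pt_self, pt_of_ne hab,
      pt_of_ne hsa, pt_of_ne hta, pt_of_ne hsb, pt_of_ne htb, pt_of_ne hst, pt_of_ne (Ne.symm hst),
      pt_of_ne hsa.symm, pt_of_ne hta.symm]
    simp
  have hr : [(node a L R, s), (node b L' R', t)] ~r [(node b L' R', t), (node a L R, s)] :=
    ⟨1, rfl⟩
  obtain ⟨h1, h2⟩ := key hG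
  obtain ⟨h3, h4⟩ := key ((labels_perm_of_perm hr.perm).nodup_iff.1 hG)
  rw [← mat_eq_of_isRotated hr] at h3 h4
  have := hf _ _ (h1 ▸ one_pos)
  have := hf _ _ (h2 ▸ one_pos)
  have := hf _ _ (h3 ▸ one_pos)
  have := hf _ _ (h4 ▸ one_pos)
  omega

end Forest

end ClusterQuiver

namespace ClusterQuiver

open BinaryTree List

variable {V : Type*} [DecidableEq V]

namespace Forest

theorem mat_comb_eq (v w : V) (vs : List V) (s : V) :
    mat [(comb (v :: w :: vs), s)] = wedge (pt w) (pt v + pt s) + (comb (w :: vs)).mat := by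
  have h : (nil : BinaryTree V).topInd = 0 := rfl
  have h' : (comb (w :: vs)).topInd = pt w := rfl
  rw [mat, comb, fatMat, topInd_node, h, h', tri_zero_left]
  simp [BinaryTree.mat]

/-- The matrix of the linear orientation of the Dynkin diagram `D_n`: the arrows are graded. -/
theorem mat_comb_pos {v w s : V} {vs : List V} (hl : (v :: w :: vs).Nodup)
    (hs : s ∉ v :: w :: vs) {i j : V} (h : 0 < mat [(comb (v :: w :: vs), s)] i j) :
    i ≠ s ∧ i ∈ v :: w :: vs ∧ (if i = s then 0 else (v :: w :: vs).idxOf i) =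
      (if j = s then 0 else (v :: w :: vs).idxOf j) + 1 := by
  rw [mat_comb_eq, Pi.add_apply, Pi.add_apply] at h
  have hv := nodup_cons.1 hl
  have hvw : v ≠ w := by rintro rfl; exact hv.1 mem_cons_self
  have hsw : s ≠ w := by rintro rfl; exact hs (by simp)
  have hsv : s ≠ v := by rintro rfl; exact hs (by simp)
  have hidx : (v :: w :: vs).idxOf w = 1 := by
    rw [idxOf_cons_ne _ hvw]; simp
  by_cases h' : 0 < (comb (w :: vs)).mat i j
  · obtain ⟨h1, h2, h3⟩ := mem_of_mat_comb_pos hv.2 h'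
    have h4 : i ≠ s := by rintro rfl; exact hs (mem_cons_of_mem _ h1)
    have h5 : j ≠ s := by rintro rfl; exact hs (mem_cons_of_mem _ h2)
    have h6 : v ≠ i := by rintro rfl; exact hv.1 h1
    have h7 : v ≠ j := by rintro rfl; exact hv.1 h2
    refine ⟨h4, mem_cons_of_mem _ h1, ?_⟩
    rw [if_neg h4, if_neg h5, idxOf_cons_ne _ h6, idxOf_cons_ne _ h7, h3]
  · have h1 : 0 < wedge (pt w) (pt v + pt s) i j := by omega
    simp only [wedge, Pi.add_apply, pt_apply] at h1
    have hij : i = w ∧ (j = v ∨ j = s) := by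
      split_ifs at h1 <;> simp_all
    obtain ⟨rfl, rfl | rfl⟩ := hij
    · refine ⟨hsw.symm, by simp, ?_⟩
      rw [if_neg hsw.symm, if_neg hsv.symm, hidx]
      simp
    · refine ⟨hsw.symm, by simp, ?_⟩
      rw [if_neg hsw.symm, if_pos rfl, hidx]

/-- Sources of arrows into `k` have equal height. Only `v` and `s` share a height, and `s` is never
a source. -/
theorem mat_comb_unique_in {v w s : V} {vs : List V} (hl : (v :: w :: vs).Nodup)
    (hs : s ∉ v :: w :: vs) {i j k : V} (hi : 0 < mat [(comb (v :: w :: vs), s)] i k)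
    (hj : 0 < mat [(comb (v :: w :: vs), s)] j k) : i = j := by
  obtain ⟨h1, h2, h3⟩ := mat_comb_pos hl hs hi
  obtain ⟨h4, h5, h6⟩ := mat_comb_pos hl hs hj
  rw [if_neg h1] at h3
  rw [if_neg h4, ← h3] at h6
  exact (idxOf_inj h2).1 h6.symm

/-- Two targets of arrows from one vertex have equal height, and only `v` and `s` do, both at height
`0`. -/
theorem mat_comb_two_out {v w s : V} {vs : List V} (hl : (v :: w :: vs).Nodup)
    (hs : s ∉ v :: w :: vs) (hV : ∀ i, i = s ∨ i ∈ v :: w :: vs) {i j k : V}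
    (hj : 0 < mat [(comb (v :: w :: vs), s)] i j)
    (hk : 0 < mat [(comb (v :: w :: vs), s)] i k) (hjk : j ≠ k) :
    i = w ∧ (j = v ∧ k = s ∨ j = s ∧ k = v) := by
  obtain ⟨h1, h2, h3⟩ := mat_comb_pos hl hs hj
  obtain ⟨-, -, h6⟩ := mat_comb_pos hl hs hk
  rw [h3] at h6
  have h6 := Nat.succ_injective h6
  rw [if_neg h1] at h3
  have hv : v ∈ v :: w :: vs := mem_cons_self
  have hvw : v ≠ w := by rintro rfl; exact (nodup_cons.1 hl).1 mem_cons_self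
  have hidx : (v :: w :: vs).idxOf w = 1 := by
    rw [idxOf_cons_ne _ hvw]; simp
  have hidv : (v :: w :: vs).idxOf v = 0 := by simp
  have hi (h : (v :: w :: vs).idxOf i = 1) : i = w := (idxOf_inj h2).1 (h.trans hidx.symm)
  by_cases hjs : j = s
  · have hks : k ≠ s := fun h => hjk (hjs.trans h.symm)
    rw [if_pos hjs, if_neg hks] at h6
    rw [if_pos hjs] at h3
    exact ⟨hi h3, Or.inr ⟨hjs, ((idxOf_inj hv).1 (hidv.trans h6)).symm⟩⟩
  · by_cases hks : k = s
    · rw [if_neg hjs, if_pos hks] at h6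
      rw [if_neg hjs, h6] at h3
      exact ⟨hi h3, Or.inl ⟨((idxOf_inj hv).1 (hidv.trans h6.symm)).symm, hks⟩⟩
    · rw [if_neg hjs, if_neg hks] at h6
      exact absurd ((idxOf_inj ((hV j).resolve_left hjs)).1 h6) hjk

/-- The forest gives `q → a → p` with `q` a source. A right child of `a` would be a second vertex
with an arrow into `a`, so there is a left child `c`, and `a → p`, `a → c` identify `a` with the
branching vertex `w`. Then `q = u`, the only vertex with an arrow into `w`, contradicting `z → u`.
The vertex `z` exists because there are at least five vertices; for D_4 such forests do share the
quiver of the comb. -/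
theorem not_node_nil {v w u z s : V} {vs : List V} (hl : (v :: w :: u :: z :: vs).Nodup)
    (hs : s ∉ v :: w :: u :: z :: vs) (hV : ∀ i, i = s ∨ i ∈ v :: w :: u :: z :: vs)
    {a p q : V} {L R : BinaryTree V} (hG : Valid [(node a L R, p), (nil, q)])
    (h : mat [(node a L R, p), (nil, q)] = mat [(comb (v :: w :: u :: z :: vs), s)]) : False := by
  set M := mat [(comb (v :: w :: u :: z :: vs), s)] with hM
  obtain ⟨hG, hG'⟩ := hG
  simp only [labels_cons, labels_nil, nodup_append, nodup_cons, mem_append, mem_cons,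
    not_or] at hG
  obtain ⟨hT, ⟨⟨-, hpq, -⟩, -⟩, hTG⟩ := hG
  have hqT : q ∉ (node a L R).labels := fun h => hTG q h q (by simp) rfl
  have hpT : p ∉ (node a L R).labels := fun h => hTG p h p (by simp) rfl
  have haT : a ∈ (node a L R).labels := by simp [BinaryTree.labels]
  have hap : a ≠ p := by rintro rfl; exact hpT haT
  have haq : a ≠ q := by rintro rfl; exact hqT haT
  have hform : M = wedge (pt q) (pt a) + wedge (pt a) (pt p) + (node a L R).mat := by
    rw [← h]
    funext i j
    simp only [mat, lastSpoke, wheel, Pi.add_apply, tri_apply, topInd, Pi.zero_apply,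
      BinaryTree.mat, wedge]
    ring
  have hqa : 0 < M q a := by
    rw [hform]
    simp [wedge, mat_eq_zero hqT, pt_of_ne haq, pt_of_ne haq.symm, pt_of_ne (Ne.symm hpq),
      pt_of_ne hap]
  have hap' : 0 < M a p := by
    rw [hform]
    simp [wedge, mat_eq_zero hpT, pt_of_ne haq, pt_of_ne hap, pt_of_ne hap.symm, pt_of_ne hpq]
  have hqle (x : V) : M x q ≤ 0 := by
    rw [hform]
    simp only [Pi.add_apply, wedge, mat_eq_zero hqT, pt_of_ne haq.symm, pt_of_ne (Ne.symm hpq),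
      pt_self]
    have := pt_nonneg a x
    simp
    exact this
  obtain ⟨h1, h2, h3, h4, h5⟩ := Rot.not_mem_of_nodup hT
  have hR : R = .nil := by
    rcases R with _ | ⟨c, A, B⟩
    · rfl
    · exfalso
      have hcT : c ∈ (node a L (node c A B)).labels := by simp [BinaryTree.labels]
      have hcR : c ∈ (node c A B).labels := by simp [BinaryTree.labels]
      have hca : c ≠ a := by rintro rfl; exact h4 hcR
      have hcp : c ≠ p := by rintro rfl; exact hpT hcT
      have hcq : c ≠ q := by rintro rfl; exact hqT hcT
      have : 0 < M c a := by
        rw [hform]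
        simp [wedge, mat_node a, tri_apply, pt_of_ne hca, pt_of_ne hca.symm, pt_of_ne hcp,
          pt_of_ne hcq, topInd_eq_zero (fun h => h5 c h hcR), topInd_eq_zero h3, mat_eq_zero h3,
          mat_eq_zero h4]
      exact hcq (mat_comb_unique_in hl hs this hqa)
  subst hR
  rcases L with _ | ⟨c, A, B⟩
  · have hlen := (perm_ext_iff_of_nodup (nodup_cons.2 ⟨hs, hl⟩) (l₂ := [a, p, q])
      (by simp [hap, haq, hpq])).2
      (fun i => ⟨fun _ => by simpa [BinaryTree.labels] using hG' i, fun _ => by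
        rcases hV i with rfl | h <;> simp_all⟩)
    have := hlen.length_eq
    simp at this
  · have hcT : c ∈ (node a (node c A B) nil).labels := by simp [BinaryTree.labels]
    have hcR : c ∈ (node c A B).labels := by simp [BinaryTree.labels]
    have hca : c ≠ a := by rintro rfl; exact h3 hcR
    have hcp : c ≠ p := by rintro rfl; exact hpT hcT
    have hcq : c ≠ q := by rintro rfl; exact hqT hcT
    have hac : 0 < M a c := by
      rw [hform]
      simp [wedge, mat_node a, tri_apply, pt_of_ne hca, pt_of_ne hca.symm, pt_of_ne hcp,
        pt_of_ne haq, pt_of_ne hcq, mat_eq_zero h3, mat_eq_zero h4]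
    obtain ⟨rfl, -⟩ := mat_comb_two_out hl hs hV hap' hac hcp.symm
    have huw : 0 < M u a := by
      rw [hM, mat_comb_eq, mat_comb_cons]
      have hu : u ∉ [v] := by simp_all [eq_comm]
      have hne : a ≠ u := by rintro rfl; simp at hl
      have hsa : s ≠ a := by rintro rfl; simp at hs
      have hva : v ≠ a := by rintro rfl; simp at hl
      have hvu : v ≠ u := by rintro rfl; simp at hl
      have hsu : s ≠ u := by rintro rfl; simp at hs
      have haL : a ∉ (comb (u :: z :: vs)).labels := by
        rw [labels_comb, mem_reverse]
        exact (nodup_cons.1 (nodup_cons.1 hl).2).1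
      simp only [Pi.add_apply, wedge, topInd_comb_cons, pt_self, pt_of_ne hne, pt_of_ne hne.symm,
        pt_of_ne hvu.symm, pt_of_ne hsu.symm]
      rw [(mat_eq_zero haL u).2]
      simp
    have hzu : 0 < M z u := by
      rw [hM, mat_comb_eq, mat_comb_cons, mat_comb_cons]
      have hua : u ≠ a := by rintro rfl; simp at hl
      have huz : u ≠ z := by rintro rfl; simp at hl
      have hza : z ≠ a := by rintro rfl; simp at hl
      have hzv : z ≠ v := by rintro rfl; simp at hl
      have hzs : z ≠ s := by rintro rfl; simp at hs
      have huL : u ∉ (comb (z :: vs)).labels := by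
        rw [labels_comb, mem_reverse]
        exact (nodup_cons.1 (nodup_cons.1 (nodup_cons.1 hl).2).2).1
      simp only [Pi.add_apply, wedge, topInd_comb_cons, pt_self, pt_of_ne hua, pt_of_ne huz,
        pt_of_ne huz.symm, pt_of_ne hza, pt_of_ne hzv, pt_of_ne hzs]
      rw [(mat_eq_zero huL z).2]
      simp
    have := mat_comb_unique_in hl hs huw hqa
    subst this
    exact absurd hzu (not_lt.2 (hqle z))

theorem eq_comb_of_singleton {v w s : V} {vs : List V} (hl : (v :: w :: vs).Nodup)
    {T : BinaryTree V} (hT : T.labels ~ w :: vs) (htop : T.topInd = pt w)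
    (h : mat [(node v nil T, s)] = mat [(comb (v :: w :: vs), s)]) : T = comb (w :: vs) := by
  refine eq_comb_of_mat_eq (nodup_cons.1 hl).2 hT ?_ htop
  have h0 : (nil : BinaryTree V).topInd = 0 := rfl
  rw [mat_comb_eq, mat, fatMat, topInd_node, h0, htop, tri_zero_left] at h
  simpa [BinaryTree.mat] using h

/-- The grading excludes oriented cycles, so there are at most two spokes, and two are ruled out by
`not_node_node` and `not_node_nil`. For a sole spoke `p` with loop `r`, a left child of `r` would
receive arrows from both `r` and `p`. The right child has arrows to both, so it is `w`, and `r`, `p`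
are `v`, `s` in some order. -/
theorem rigid_comb {v w u z s : V} {vs : List V} (hl : Valid [(comb (v :: w :: u :: z :: vs), s)])
    {G : Forest V} (hG : Valid G) (h : mat G = mat [(comb (v :: w :: u :: z :: vs), s)]) :
    Equiv G [(comb (v :: w :: u :: z :: vs), s)] := by
  obtain ⟨hl1, hV⟩ := hl
  simp only [labels_cons, labels_nil, labels_comb] at hl1 hV
  have hV' (i : V) : i = s ∨ i ∈ v :: w :: u :: z :: vs := by
    rcases mem_append.1 (hV i) with h | h
    · exact Or.inr (mem_reverse.1 h)
    · exact Or.inl (mem_singleton.1 h)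
  have hs : s ∉ v :: w :: u :: z :: vs := by
    rw [nodup_append] at hl1
    exact fun h => hl1.2.2 s (mem_reverse.2 h) s (by simp) rfl
  have hl : (v :: w :: u :: z :: vs).Nodup := nodup_reverse.1 (nodup_append.1 hl1).1
  have hperm : labels G ~ s :: v :: w :: u :: z :: vs :=
    (perm_ext_iff_of_nodup hG.1 (nodup_cons.2 ⟨hs, hl⟩)).2
      fun i => ⟨fun _ => mem_cons.2 (hV' i), fun _ => hG.2 i⟩
  have hf (i j : V) (h' : 0 < mat G i j) :
      (if j = s then 0 else (v :: w :: u :: z :: vs).idxOf j) <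
        (if i = s then 0 else (v :: w :: u :: z :: vs).idxOf i) := by
    rw [h] at h'
    rw [(mat_comb_pos hl hs h').2.2]
    exact Nat.lt_succ_self _
  have hlen := length_le_two hG.1 _ hf
  rcases G with _ | ⟨⟨T, p⟩, _ | ⟨⟨U, q⟩, _ | ⟨r, G⟩⟩⟩
  · have := hperm.length_eq
    simp at this
  · rcases T with _ | ⟨r, L, R⟩
    · have := hperm.length_eq
      simp [BinaryTree.labels] at this
    obtain ⟨hG1, hG2⟩ := hG
    simp only [labels_cons, labels_nil, nodup_append] at hG1
    obtain ⟨hT, -, hTp⟩ := hG1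
    have hpT : p ∉ (node r L R).labels := fun h => hTp p h p (by simp) rfl
    obtain ⟨h1, h2, h3, h4, h5⟩ := Rot.not_mem_of_nodup hT
    simp only [BinaryTree.labels, mem_append, mem_singleton, not_or] at hpT
    obtain ⟨⟨hpL, hpR⟩, hpr⟩ := hpT
    have hform : mat [(node r L R, p)] = tri (pt r + pt p) L.topInd R.topInd + L.mat + R.mat := rfl
    have hL : L = .nil := by
      rcases L with _ | ⟨c, A, B⟩
      · rfl
      · exfalso
        have hcL : c ∈ (node c A B).labels := by simp [BinaryTree.labels]
        have hcr : c ≠ r := by rintro rfl; exact h3 hcL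
        have hcp : c ≠ p := by rintro rfl; exact hpL hcL
        have hrc : 0 < mat [(node r (node c A B) R, p)] r c := by
          rw [hform]
          simp [tri_apply, pt_of_ne hcr, pt_of_ne hcr.symm, pt_of_ne hcp, pt_of_ne (Ne.symm hpr),
            topInd_eq_zero h4, topInd_eq_zero (h5 c hcL), mat_eq_zero h3, mat_eq_zero h4]
        have hpc : 0 < mat [(node r (node c A B) R, p)] p c := by
          rw [hform]
          simp [tri_apply, pt_of_ne hcr, pt_of_ne hpr, pt_of_ne hcp, pt_of_ne hcp.symm,
            topInd_eq_zero hpR, topInd_eq_zero (h5 c hcL), mat_eq_zero hpL, mat_eq_zero hpR]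
        rw [h] at hrc hpc
        exact hpr (mat_comb_unique_in hl hs hpc hrc)
    subst hL
    rcases R with _ | ⟨c, A, B⟩
    · have := hperm.length_eq
      simp [BinaryTree.labels] at this
    have hcR : c ∈ (node c A B).labels := by simp [BinaryTree.labels]
    have hcr : c ≠ r := by rintro rfl; exact h4 hcR
    have hcp : c ≠ p := by rintro rfl; exact hpR hcR
    have hcr' : 0 < mat [(node r nil (node c A B), p)] c r := by
      rw [hform]
      simp [tri_apply, pt_of_ne hcr, pt_of_ne hcr.symm, pt_of_ne hcp, pt_of_ne (Ne.symm hpr),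
        topInd, BinaryTree.mat_eq_zero h3, mat_eq_zero h4]
    have hcp' : 0 < mat [(node r nil (node c A B), p)] c p := by
      rw [hform]
      simp [tri_apply, pt_of_ne hcr, pt_of_ne hpr, pt_of_ne hcp, pt_of_ne hcp.symm,
        topInd, mat_eq_zero hpL, mat_eq_zero hpR]
    rw [h] at hcr' hcp'
    obtain ⟨rfl, hrp⟩ := mat_comb_two_out hl hs hV' hcr' hcp' (Ne.symm hpr)
    have hperm' : (node c A B).labels ++ [r, p] ~ (c :: u :: z :: vs) ++ [r, p] := by
      rw [labels_cons, labels_nil] at hperm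
      have e1 : (node r nil (node c A B)).labels ++ [p] = (node c A B).labels ++ [r, p] := by
        simp [BinaryTree.labels]
      rw [e1] at hperm
      refine hperm.trans ?_
      rcases hrp with ⟨rfl, rfl⟩ | ⟨rfl, rfl⟩
      · exact (Perm.swap _ _ _).trans (perm_append_comm (l₁ := [r, p]))
      · exact perm_append_comm (l₁ := [r, p])
    have hperm'' := (perm_append_right_iff _).1 hperm'
    rcases hrp with ⟨rfl, rfl⟩ | ⟨rfl, rfl⟩
    · rw [eq_comb_of_singleton hl hperm'' rfl h]
      exact Equiv.refl _
    -- Here `v` and `s` appear in the opposite order, so loop and spoke are exchanged before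
    -- comparing trees.
    · have hE : Equiv [(node r nil (node c A B), p)] [(node p nil (node c A B), r)] :=
        Or.inr ⟨_, _, _, _, rfl, rfl⟩
      rw [hE.mat_eq] at h
      have := eq_comb_of_singleton hl hperm'' rfl h
      rw [this] at hE ⊢
      exact hE
  · exfalso
    have hr : [(T, p), (U, q)] ~r [(U, q), (T, p)] := ⟨1, rfl⟩
    have hG' := hG.of_perm (labels_perm_of_perm hr.perm)
    have hr' := mat_eq_of_isRotated hr
    rcases T with _ | ⟨a, L, R⟩
    · rcases U with _ | ⟨b, L', R'⟩
      · have := hperm.length_eq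
        simp [BinaryTree.labels] at this
      · exact not_node_nil hl hs hV' hG' (hr'.symm.trans h)
    · rcases U with _ | ⟨b, L', R'⟩
      · exact not_node_nil hl hs hV' hG h
      · exact not_node_node hG.1 _ hf
  · simp at hlen

end Forest

theorem rigid_of_skew_eq_mat {n : ℕ} (e : V ≃ Fin n) (hn : 5 ≤ n) {Q : ClusterQuiver V}
    {F : Forest V} (hF : Forest.Valid F) (hQ : Q.skew = Forest.mat F) : Q.Rigid := by
  have hlen := hF.length_eq e
  rcases F with _ | ⟨⟨T, s⟩, F⟩
  · simp at hlen; omega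
  obtain ⟨vs, t, h⟩ := Forest.exists_reach_comb F T s
  obtain ⟨Q', h1, h2⟩ := h.exists_skew_eq hF.1 hQ
  refine Rigid.of_mutationEquiv e (by omega) (Q := Q') ?_ h1.symm
  have hC := hF.of_perm h.labels_perm
  have hlen' := hC.length_eq e
  rw [Forest.labels_cons, labels_comb] at hlen'
  rcases vs with _ | ⟨v, _ | ⟨w, _ | ⟨u, _ | ⟨z, vs⟩⟩⟩⟩
  iterate 4 · simp at hlen'; omega
  intro F G hF hG hQF hQG
  exact (Forest.rigid_comb hC hF (hQF.symm.trans h2)).trans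
    (Forest.rigid_comb hC hG (hQG.symm.trans h2)).symm

end ClusterQuiver

/-! ### Orientations of the Dynkin diagram D_n come from triangulations. -/

namespace ClusterQuiver

open BinaryTree List

variable {V : Type*}

/-- The tree whose triangles form the chain `u 0, u 1, …, u k`, with arrows directed as in `Q`. -/
def caterpillar (Q : ClusterQuiver V) (u : ℕ → V) : ℕ → BinaryTree V
  | 0 => node (u 0) .nil .nil
  | k + 1 => if Q.skew (u k) (u (k + 1)) = 1 then node (u (k + 1)) .nil (caterpillar Q u k)
    else node (u (k + 1)) (caterpillar Q u k) .nil

variable (Q : ClusterQuiver V) (u : ℕ → V)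

theorem labels_caterpillar (k : ℕ) :
    (caterpillar Q u k).labels = (range (k + 1)).map u := by
  induction k with
  | zero => simp [caterpillar, BinaryTree.labels]
  | succ k ih =>
    rw [range_succ, map_append, ← ih, caterpillar]
    split_ifs <;> simp [BinaryTree.labels]

variable [DecidableEq V]

theorem topInd_caterpillar (k : ℕ) : (caterpillar Q u k).topInd = pt (u k) := by
  cases k with
  | zero => rfl
  | succ k => rw [caterpillar]; split_ifs <;> rfl

theorem mat_caterpillar (k : ℕ)
    (h : ∀ i < k, Q.skew (u i) (u (i + 1)) = 1 ∨ Q.skew (u i) (u (i + 1)) = -1) (x y : V) :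
    (caterpillar Q u k).mat x y =
      ∑ i ∈ Finset.range k, Q.skew (u i) (u (i + 1)) * wedge (pt (u i)) (pt (u (i + 1))) x y := by
  induction k with
  | zero => simp [caterpillar, BinaryTree.mat, tri_apply]
  | succ k ih =>
    have := ih fun i hi => h i (hi.trans (Nat.lt_succ_self k))
    rw [Finset.sum_range_succ, ← this, caterpillar]
    rcases h k (Nat.lt_succ_self k) with h | h
    · rw [if_pos h, h, mat_node, topInd_caterpillar]
      simp [tri_apply, wedge, BinaryTree.mat]
      ring
    · rw [if_neg (by rw [h]; decide), h, mat_node, topInd_caterpillar]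
      simp [tri_apply, wedge, BinaryTree.mat]
      ring

open Forest in
/-- Every orientation of the Dynkin diagram `D_n` comes from a triangulation. -/
theorem IsDynkinD.exists_forest {n : ℕ} (hn : 4 ≤ n) {Q : ClusterQuiver V} (hQ : Q.IsDynkinD n) :
    ∃ F, Valid F ∧ Q.skew = mat F := by
  obtain ⟨e, he⟩ := hQ
  -- The branching vertex is `m`: it ends the chain `0, …, m` and has the two further neighbours `m
  -- + 1` and `m + 2`.
  obtain ⟨m, rfl⟩ : ∃ m, n = m + 3 := ⟨n - 3, by omega⟩
  let u : ℕ → V := fun k => if h : k < m + 3 then e.symm ⟨k, h⟩ else e.symm 0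
  have hu (k : ℕ) (h : k < m + 3) : e (u k) = ⟨k, h⟩ := by simp [u, h]
  have hsurj (x : V) : ∃ k < m + 3, u k = x :=
    ⟨e x, (e x).2, by simp [u]⟩
  have hinj {p q : ℕ} (hp : p < m + 3) (hq : q < m + 3) : u p = u q ↔ p = q := by
    refine ⟨fun h => ?_, fun h => by rw [h]⟩
    have := congrArg e h
    rw [hu p hp, hu q hq] at this
    simpa using this
  have hS {p q : ℕ} (hp : p < m + 3) (hq : q < m + 3) (hpq : p < q) :
      (if p + 1 = q ∧ p < m + 1 ∨ p = m ∧ q = m + 2 then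
        (Q.skew (u p) (u q) = 1 ∨ Q.skew (u p) (u q) = -1) ∧ ¬ (p = m + 1)
        else Q.skew (u p) (u q) = 0) := by
    have h := he (u p) (u q) (fun h => hpq.ne ((hinj hp hq).1 h))
    have h2 := Q.no_two_cycle (u p) (u q)
    rw [hu p hp, hu q hq] at h
    simp only [CartanMatrix.D, Matrix.of_apply, Fin.mk.injEq] at h
    unfold skew
    split_ifs at h ⊢ <;> omega
  have hchain : ∀ i < m, Q.skew (u i) (u (i + 1)) = 1 ∨ Q.skew (u i) (u (i + 1)) = -1 := by
    intro i hi
    have := hS (p := i) (q := i + 1) (by omega) (by omega) (by omega)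
    rw [if_pos (by omega)] at this
    exact this.1
  have ha := hS (p := m) (q := m + 1) (by omega) (by omega) (by omega)
  rw [if_pos (by omega)] at ha
  have hb := hS (p := m) (q := m + 2) (by omega) (by omega) (by omega)
  rw [if_pos (by omega)] at hb
  set C := caterpillar Q u m with hC
  have hskew : Q.skew = C.mat +
      (fun x y => Q.skew (u m) (u (m + 1)) * wedge (pt (u m)) (pt (u (m + 1))) x y) +
      (fun x y => Q.skew (u m) (u (m + 2)) * wedge (pt (u m)) (pt (u (m + 2))) x y) := by
    funext x y
    have key (p q : ℕ) (hp : p < m + 3) (hq : q < m + 3) (hpq : p < q) : Q.skew (u p) (u q) =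
        C.mat (u p) (u q) +
        Q.skew (u m) (u (m + 1)) * wedge (pt (u m)) (pt (u (m + 1))) (u p) (u q) +
        Q.skew (u m) (u (m + 2)) * wedge (pt (u m)) (pt (u (m + 2))) (u p) (u q) := by
      have hw (i j : ℕ) (hi : i < m + 3) (hj : j < m + 3) (hij : i < j) :
          wedge (pt (u i)) (pt (u j)) (u p) (u q) = if p = i ∧ q = j then 1 else 0 := by
        simp only [wedge, pt_apply, hinj hp hi, hinj hq hj, hinj hq hi, hinj hp hj]
        split_ifs <;> omega
      have hsum : C.mat (u p) (u q) = if p < m ∧ q = p + 1 then Q.skew (u p) (u (p + 1)) else 0 := by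
        rw [hC, mat_caterpillar Q u m hchain]
        rw [Finset.sum_congr rfl fun i hi => by
          rw [hw i (i + 1) (by have := Finset.mem_range.1 hi; omega)
            (by have := Finset.mem_range.1 hi; omega) (by omega)]]
        by_cases h : p < m ∧ q = p + 1
        · rw [if_pos h, Finset.sum_eq_single p]
          · simp [h.2]
          · intro i _ hi
            rw [if_neg (by omega), mul_zero]
          · intro hp
            exact absurd (Finset.mem_range.2 h.1) hp
        · rw [if_neg h]
          refine Finset.sum_eq_zero fun i hi => ?_
          have := Finset.mem_range.1 hi
          rw [if_neg (by omega), mul_zero]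
      rw [hw m (m + 1) (by omega) (by omega) (by omega),
        hw m (m + 2) (by omega) (by omega) (by omega), hsum]
      have h0 := hS hp hq hpq
      by_cases h1 : p < m ∧ q = p + 1
      · obtain ⟨h1, rfl⟩ := h1
        rw [if_pos ⟨h1, rfl⟩, if_neg (by omega), if_neg (by omega)]
        ring
      · rw [if_neg h1]
        by_cases h2 : p = m ∧ q = m + 1
        · obtain ⟨rfl, rfl⟩ := h2
          simp
        · rw [if_neg h2]
          by_cases h3 : p = m ∧ q = m + 2
          · obtain ⟨rfl, rfl⟩ := h3
            simp
          · rw [if_neg h3]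
            rw [if_neg (by omega)] at h0
            rw [h0]
            ring
    obtain ⟨p, hp, rfl⟩ := hsurj x
    obtain ⟨q, hq, rfl⟩ := hsurj y
    have hwswap (a b : V → ℤ) (x y : V) : wedge a b y x = -wedge a b x y := by
      unfold wedge; ring
    simp only [Pi.add_apply]
    rcases lt_trichotomy p q with h | rfl | h
    · exact key p q hp hq h
    · rw [skew_swap, skew]
      have := BinaryTree.mat_swap C (u p) (u p)
      have h0 : C.mat (u p) (u p) = 0 := by omega
      simp [h0, wedge, mul_comm]
    · rw [skew_swap, key q p hq hp h, BinaryTree.mat_swap C (u p), hwswap _ _ (u q) (u p),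
        hwswap _ _ (u q) (u p)]
      ring
  have hvalid {F : Forest V} (h : labels F ~ (range (m + 3)).map u) : Valid F := by
    refine Valid.of_perm (F := [(C, u (m + 1)), (.nil, u (m + 2))]) ?_ (Perm.trans ?_ h.symm)
    · have hl : labels [(C, u (m + 1)), (.nil, u (m + 2))] = (range (m + 3)).map u := by
        rw [range_succ, range_succ, map_append, map_append, ← labels_caterpillar Q u m]
        simp [BinaryTree.labels, hC]
      refine ⟨?_, fun v => ?_⟩
      · rw [hl, nodup_map_iff_inj_on nodup_range]
        intro p hp q hq h
        exact (hinj (mem_range.1 hp) (mem_range.1 hq)).1 h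
      · rw [hl, mem_map]
        obtain ⟨k, hk, rfl⟩ := hsurj v
        exact ⟨k, mem_range.2 hk, rfl⟩
    · rw [range_succ, range_succ, map_append, map_append, ← labels_caterpillar Q u m]
      simp [BinaryTree.labels, hC]
  have hvalid' {F : Forest V} (h : labels F ~ C.labels ++ [u (m + 1), u (m + 2)]) : Valid F := by
    apply hvalid
    rw [range_succ, range_succ, map_append, map_append, ← labels_caterpillar Q u m]
    simpa [hC] using h
  have htop : C.topInd = pt (u m) := topInd_caterpillar Q u m
  -- If both fork arrows leave `u m`, or both enter it, the ends of the fork are loop and spoke of a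
  -- self-folded triangle. Otherwise they are two spokes with `C` on one side and a boundary edge on
  -- the other; the arrows between them cancel.
  rcases ha.1 with ha | ha <;> rcases hb.1 with hb | hb <;> rw [ha, hb] at hskew
  · refine ⟨[(node (u (m + 1)) .nil C, u (m + 2))], hvalid' ?_, ?_⟩
    · simp [BinaryTree.labels]
    · rw [hskew]
      funext x y
      simp [Forest.mat, fatMat, htop, tri_apply, wedge, BinaryTree.mat]
      ring
  · refine ⟨[(C, u (m + 1)), (.nil, u (m + 2))], hvalid' ?_, ?_⟩
    · simp [BinaryTree.labels]
    · rw [hskew]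
      funext x y
      simp [Forest.mat, wheel, lastSpoke, htop, tri_apply, wedge, BinaryTree.mat]
      ring
  · refine ⟨[(C, u (m + 2)), (.nil, u (m + 1))], hvalid' ?_, ?_⟩
    · simpa [BinaryTree.labels] using (Perm.swap (u (m + 1)) (u (m + 2)) []).append_left _
    · rw [hskew]
      funext x y
      simp [Forest.mat, wheel, lastSpoke, htop, tri_apply, wedge, BinaryTree.mat]
      ring
  · refine ⟨[(node (u (m + 1)) C .nil, u (m + 2))], hvalid' ?_, ?_⟩
    · simp [BinaryTree.labels]
    · rw [hskew]
      funext x y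
      simp [Forest.mat, fatMat, htop, tri_apply, wedge, BinaryTree.mat]
      ring

end ClusterQuiver

/-! ### Postfix words of forests and the cycle lemma. -/

namespace ClusterQuiver

open BinaryTree List

variable {α β V : Type*}

/-- The weight of a letter. -/
def letterWt : Option α → ℤ
  | none => 1
  | some _ => -1

/-- The pathHeight reached by a lattice path. -/
def pathHeight (w : List (Option α)) : ℤ := (w.map letterWt).sum

@[simp] theorem pathHeight_nil : pathHeight ([] : List (Option α)) = 0 := rfl

@[simp] theorem pathHeight_append (u v : List (Option α)) : pathHeight (u ++ v) = pathHeight u + pathHeight v := by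
  simp [pathHeight]

@[simp] theorem pathHeight_cons (a : Option α) (v : List (Option α)) :
    pathHeight (a :: v) = letterWt a + pathHeight v := by
  simp [pathHeight]

/-- A lattice path which stays at nonnegative pathHeight. -/
def Nonneg (w : List (Option α)) : Prop := ∀ u, u <+: w → 0 ≤ pathHeight u

theorem Nonneg.of_prefix {u w : List (Option α)} (hw : Nonneg w) (h : u <+: w) : Nonneg u :=
  fun v hv => hw v (hv.trans h)

end ClusterQuiver

namespace BinaryTree

open ClusterQuiver List

variable {α β V : Type*}

/-- The postfix notation of a tree, the leaves being denoted by `none`. -/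
def enc : BinaryTree α → List (Option α)
  | nil => [none]
  | node a l r => enc l ++ enc r ++ [some a]

theorem pathHeight_enc (T : BinaryTree α) : pathHeight T.enc = 1 := by
  induction T with
  | nil => rfl
  | node a l r hl hr => simp [enc, hl, hr, letterWt]

/-- Postfix notation is decoded from the right: the last letter distinguishes leaf from node, then
the right and the left subtree are split off. The arbitrary prefixes make the induction work. -/
theorem append_enc_inj {T T' : BinaryTree α} {u u' : List (Option α)}
    (h : u ++ T.enc = u' ++ T'.enc) : u = u' ∧ T = T' := by
  induction T generalizing T' u u' with
  | nil =>
    cases T' with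
    | nil => simpa [enc] using h
    | node a l r =>
      simp only [enc, ← append_assoc] at h
      have := append_inj' h rfl
      simp at this
  | node a l r hl hr =>
    cases T' with
    | nil =>
      simp only [enc, ← append_assoc] at h
      have := append_inj' h rfl
      simp at this
    | node a' l' r' =>
      simp only [enc, ← append_assoc] at h
      obtain ⟨h1, h2⟩ := append_inj' h rfl
      obtain ⟨h3, rfl⟩ := hr h1
      obtain ⟨h4, rfl⟩ := hl h3
      simp at h2
      exact ⟨h4, by rw [h2]⟩

theorem reduceOption_enc (T : BinaryTree α) : T.enc.reduceOption = T.labels := by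
  induction T with
  | nil => rfl
  | node a l r hl hr => simp [enc, labels, reduceOption_append, hl, hr]

theorem enc_map (f : α → β) (T : BinaryTree α) : (T.map f).enc = T.enc.map (Option.map f) := by
  induction T with
  | nil => rfl
  | node a l r hl hr => simp [enc, BinaryTree.map, hl, hr]

end BinaryTree

namespace ClusterQuiver

open BinaryTree List

variable {α β V : Type*}

namespace Forest

/-- The word of a forest. -/
def enc (F : Forest α) : List (Option α) := F.flatMap fun p => p.1.enc ++ [some p.2]

@[simp] theorem enc_nil : enc ([] : Forest α) = [] := rfl

@[simp] theorem enc_cons (T : BinaryTree α) (s : α) (F : Forest α) :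
    enc ((T, s) :: F) = T.enc ++ some s :: enc F := by simp [enc]

@[simp] theorem enc_append (F G : Forest α) : enc (F ++ G) = enc F ++ enc G := by simp [enc]

theorem pathHeight_enc (F : Forest α) : pathHeight (enc F) = 0 := by
  induction F with
  | nil => rfl
  | cons p F ih => obtain ⟨T, s⟩ := p; simp [ih, BinaryTree.pathHeight_enc, letterWt]

theorem enc_injective : Function.Injective (enc : Forest α → List (Option α)) := by
  intro F G h
  induction F using List.reverseRecOn generalizing G with
  | nil =>
    rcases G with _ | ⟨⟨T, s⟩, G⟩
    · rfl
    · simp at h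
  | append_singleton F p ih =>
    rcases eq_nil_or_concat G with rfl | ⟨G, q, rfl⟩
    · obtain ⟨T, s⟩ := p
      simp at h
    · obtain ⟨T, s⟩ := p
      obtain ⟨U, t⟩ := q
      simp only [enc_append, enc_cons, enc_nil, ← append_assoc, concat_eq_append] at h
      obtain ⟨h1, h2⟩ := append_inj' h rfl
      obtain ⟨h3, rfl⟩ := append_enc_inj h1
      simp at h2
      rw [ih h3, h2, concat_eq_append]

/-- `S` is the stack of a postfix evaluation. The letter `none` pushes a leaf; `some a` joins the
two top trees, or closes a region with the spoke `a` if only one tree is left. An empty stack would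
make the height negative. -/
theorem exists_enc_of_nonneg {w : List (Option α)} (hw : Nonneg w) :
    ∃ (F : Forest α) (S : List (BinaryTree α)),
      w = enc F ++ S.reverse.flatMap BinaryTree.enc := by
  induction w using List.reverseRecOn with
  | nil => exact ⟨[], [], rfl⟩
  | append_singleton w a ih =>
    obtain ⟨F, S, rfl⟩ := ih (hw.of_prefix (prefix_append _ _))
    rcases a with _ | a
    · exact ⟨F, .nil :: S, by simp [BinaryTree.enc]⟩
    · rcases S with _ | ⟨T, _ | ⟨U, S⟩⟩
      · have := hw _ (prefix_refl _)
        simp [pathHeight_enc, letterWt] at this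
      · exact ⟨F ++ [(T, a)], [], by simp⟩
      · exact ⟨F, node a U T :: S, by simp [BinaryTree.enc]⟩

theorem exists_enc_eq {w : List (Option α)} (hw : Nonneg w) (h0 : pathHeight w = 0) :
    ∃ F : Forest α, enc F = w := by
  obtain ⟨F, S, rfl⟩ := exists_enc_of_nonneg hw
  rcases S with _ | ⟨T, S⟩
  · exact ⟨F, by simp⟩
  · exfalso
    have h (S : List (BinaryTree α)) : 0 ≤ pathHeight (S.flatMap BinaryTree.enc) := by
      induction S with
      | nil => simp
      | cons T S ih => simp [BinaryTree.pathHeight_enc]; omega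
    have := h S.reverse
    simp [pathHeight_enc, BinaryTree.pathHeight_enc] at h0 this
    omega

theorem prefix_append_cases {u v w : List α} (h : u <+: v ++ w) :
    u <+: v ∨ ∃ t, t <+: w ∧ u = v ++ t := by
  rcases prefix_or_prefix_of_prefix h (prefix_append v w) with h' | ⟨t, rfl⟩
  · exact Or.inl h'
  · exact Or.inr ⟨t, (prefix_append_right_inj v).1 h, rfl⟩

theorem one_le_pathHeight_of_prefix_enc {T : BinaryTree α} {u : List (Option α)} (h : u <+: T.enc)
    (hu : u ≠ []) : 1 ≤ pathHeight u := by
  induction T generalizing u with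
  | nil =>
    obtain ⟨t, ht⟩ := h
    rcases u with _ | ⟨a, u⟩
    · exact absurd rfl hu
    · simp [BinaryTree.enc] at ht
      simp [ht, letterWt]
  | node a l r hl hr =>
    rcases prefix_append_cases h with h | ⟨t, ht, rfl⟩
    · rcases prefix_append_cases h with h | ⟨t, ht, rfl⟩
      · exact hl h hu
      · rcases eq_or_ne t [] with rfl | h0
        · simp [BinaryTree.pathHeight_enc]
        · have := hr ht h0
          simp [BinaryTree.pathHeight_enc]
          omega
    · rcases t with _ | ⟨b, t⟩
      · simp [BinaryTree.pathHeight_enc]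
      · obtain ⟨t', ht⟩ := ht
        simp at ht
        simp [BinaryTree.pathHeight_enc, ht, letterWt]

theorem nonneg_enc (F : Forest α) : Nonneg (enc F) := by
  induction F with
  | nil => intro u hu; simp at hu; simp [hu]
  | cons p F ih =>
    obtain ⟨T, s⟩ := p
    intro u hu
    rw [enc_cons] at hu
    rcases prefix_append_cases hu with h | ⟨t, ht, rfl⟩
    · rcases eq_or_ne u [] with rfl | h0
      · simp
      · have := one_le_pathHeight_of_prefix_enc h h0
        omega
    · rcases t with _ | ⟨b, t⟩
      · simp [BinaryTree.pathHeight_enc]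
      · rw [cons_prefix_cons] at ht
        have := ih t ht.2
        simpa [BinaryTree.pathHeight_enc, ht.1, letterWt] using this

/-- The rotation cuts the word into a prefix of `enc F` and a prefix of `enc G`. Both have
nonnegative height and the sum is zero, so both heights vanish and the cut falls between two
regions. -/
theorem isRotated_of_enc {F G : Forest α} (h : enc F ~r enc G) : F ~r G := by
  obtain ⟨n, hn, h⟩ := isRotated_iff_mod.1 h
  rw [rotate_eq_drop_append_take hn] at h
  set u := (enc F).take n
  set v := (enc F).drop n
  have huv : u ++ v = enc F := take_append_drop _ _
  have hu : Nonneg u := (nonneg_enc F).of_prefix (huv ▸ prefix_append _ _)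
  have hv : Nonneg v := (nonneg_enc G).of_prefix (h ▸ prefix_append _ _)
  have hsum : pathHeight u + pathHeight v = 0 := by rw [← pathHeight_append, huv, pathHeight_enc]
  have hu0 := hu u (prefix_refl _)
  have hv0 := hv v (prefix_refl _)
  obtain ⟨F₁, hF₁⟩ := exists_enc_eq hu (by omega)
  obtain ⟨F₂, hF₂⟩ := exists_enc_eq hv (by omega)
  have h1 : F = F₁ ++ F₂ := enc_injective (by rw [enc_append, hF₁, hF₂, huv])
  have h2 : G = F₂ ++ F₁ := enc_injective (by rw [enc_append, hF₁, hF₂, h])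
  rw [h1, h2]
  exact isRotated_append

theorem isRotated_enc {F G : Forest α} (h : F ~r G) : enc F ~r enc G := by
  obtain ⟨n, hn, rfl⟩ := isRotated_iff_mod.1 h
  rw [rotate_eq_drop_append_take hn]
  nth_rw 1 [← take_append_drop n F]
  rw [enc_append, enc_append]
  exact isRotated_append

/-- The cycle lemma: started at a point of minimal height, the word stays nonnegative. -/
theorem exists_isRotated_enc {w : List (Option α)} (h0 : pathHeight w = 0) :
    ∃ F : Forest α, w ~r enc F := by
  obtain ⟨k, hk, hmin⟩ := (Finset.range (w.length + 1)).exists_min_image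
    (fun k => pathHeight (w.take k)) ⟨0, by simp⟩
  set u := w.take k
  set v := w.drop k
  have huv : u ++ v = w := take_append_drop _ _
  have hmin' (t : List (Option α)) (ht : t <+: w) : pathHeight u ≤ pathHeight t := by
    have := hmin t.length (Finset.mem_range.2 (Nat.lt_succ_of_le ht.length_le))
    rwa [← prefix_iff_eq_take.1 ht] at this
  have hsum : pathHeight u + pathHeight v = 0 := by rw [← pathHeight_append, huv, h0]
  have hnn : Nonneg (v ++ u) := by
    intro t ht
    rcases prefix_append_cases ht with h | ⟨t, h, rfl⟩
    · have := hmin' (u ++ t) (huv ▸ (prefix_append_right_inj u).2 h)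
      rw [pathHeight_append] at this
      omega
    · have := hmin' t (h.trans (huv ▸ prefix_append _ _))
      rw [pathHeight_append]
      omega
  obtain ⟨F, hF⟩ := exists_enc_eq hnn (by rw [pathHeight_append]; omega)
  refine ⟨F, ?_⟩
  rw [hF, ← huv]
  exact isRotated_append

theorem reduceOption_enc (F : Forest α) : (enc F).reduceOption = labels F := by
  induction F with
  | nil => rfl
  | cons p F ih =>
    obtain ⟨T, s⟩ := p
    simp [reduceOption_append, BinaryTree.reduceOption_enc, ih]

theorem enc_relabel (f : α → β) (F : Forest α) : enc (relabel f F) = (enc F).map (Option.map f) := by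
  induction F with
  | nil => rfl
  | cons p F ih =>
    obtain ⟨T, s⟩ := p
    simp only [relabel, map_cons, enc_cons, map_append, enc_map, Option.map_some] at ih ⊢
    rw [ih]

/-- The shape of a forest, a binary word. -/
def shape (F : Forest α) : List Bool := (enc F).map Option.isSome

theorem eq_map_of_map_isSome_eq {w w' : List (Option α)} {f : α → α}
    (h : w'.map Option.isSome = w.map Option.isSome)
    (h' : w'.reduceOption = w.reduceOption.map f) : w' = w.map (Option.map f) := by
  induction w generalizing w' with
  | nil => simpa using h
  | cons a w ih =>
    rcases w' with _ | ⟨a', w'⟩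
    · simp at h
    · simp only [map_cons, cons.injEq] at h
      rcases a with _ | a <;> rcases a' with _ | a' <;> simp at h h'
      · simp [ih h h']
      · simp [ih h h'.2, h'.1]

theorem exists_map_isSome_eq {b : List Bool} {l : List α} (h : b.count true = l.length) :
    ∃ w : List (Option α), w.map Option.isSome = b ∧ w.reduceOption = l := by
  induction b generalizing l with
  | nil =>
    simp at h
    exact ⟨[], rfl, by rw [List.eq_nil_of_length_eq_zero h.symm]; rfl⟩
  | cons a b ih =>
    cases a with
    | false =>
      obtain ⟨w, h1, h2⟩ := ih (l := l) (by simpa using h)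
      exact ⟨none :: w, by simp [h1], by simp [h2]⟩
    | true =>
      rcases l with _ | ⟨x, l⟩
      · simp at h
      · obtain ⟨w, h1, h2⟩ := ih (l := l) (by simpa using h)
        exact ⟨some x :: w, by simp [h1], by simp [h2]⟩

theorem pathHeight_eq_count (w : List (Option α)) :
    pathHeight w = w.length - 2 * (w.map Option.isSome).count true := by
  induction w with
  | nil => rfl
  | cons a w ih => rcases a with _ | a <;> simp [letterWt, ih] <;> ring

theorem length_reduceOption_eq (w : List (Option α)) :
    w.reduceOption.length = (w.map Option.isSome).count true := by
  induction w with
  | nil => rfl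
  | cons a w ih => rcases a with _ | a <;> simp [ih]

theorem count_shape (F : Forest α) : (shape F).count true = (labels F).length := by
  rw [shape, ← length_reduceOption_eq, reduceOption_enc]

theorem length_shape (F : Forest α) : (shape F).length = 2 * (labels F).length := by
  have h := pathHeight_eq_count (enc F)
  have h' := count_shape F
  rw [shape] at h' ⊢
  rw [pathHeight_enc, h'] at h
  rw [length_map]
  omega

theorem Equiv.shape {F G : Forest α} (h : Equiv F G) : shape F ~r shape G := by
  rcases h with h | ⟨r, s, L, R, rfl, rfl⟩
  · exact (isRotated_enc h).map _
  · simp [Forest.shape, BinaryTree.enc]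
    exact IsRotated.refl _

theorem shape_relabel (f : α → β) (F : Forest α) : shape (relabel f F) = shape F := by
  rw [shape, enc_relabel, shape, map_map]
  congr 1
  funext a
  cases a <;> rfl

/-- After a rotation the two words differ only in their labels; matching these in reading order
gives the permutation. -/
theorem exists_relabel_isRotated [DecidableEq V] {F G : Forest V} (hF : Valid F) (hG : Valid G)
    (h : shape F ~r shape G) : ∃ σ : Equiv.Perm V, relabel σ F ~r G := by
  obtain ⟨n, hn⟩ := h.symm
  rw [shape, ← map_rotate] at hn
  have hr : (enc G).rotate n ~r enc G := IsRotated.forall _ _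
  have hperm : ((enc G).rotate n).reduceOption ~ labels G := by
    rw [← reduceOption_enc]
    exact hr.perm.filterMap _
  obtain ⟨σ, hσ⟩ := exists_perm_map_eq hF.1 (hperm.nodup_iff.2 hG.1) hF.2
    fun v => hperm.mem_iff.2 (hG.2 v)
  refine ⟨σ, isRotated_of_enc ?_⟩
  rw [enc_relabel, ← eq_map_of_map_isSome_eq (f := σ) hn (by rw [reduceOption_enc, hσ])]
  exact hr

theorem exists_valid_shape {n : ℕ} (e : V ≃ Fin n) {b : List Bool} (hb : b.length = 2 * n)
    (hb' : b.count true = n) : ∃ F : Forest V, Valid F ∧ b ~r shape F := by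
  obtain ⟨w, h1, h2⟩ := exists_map_isSome_eq (b := b) (l := (finRange n).map e.symm)
    (by simp [hb'])
  have hl : w.length = 2 * n := by rw [← hb, ← h1, length_map]
  obtain ⟨F, hF⟩ := exists_isRotated_enc (w := w)
    (by rw [pathHeight_eq_count, h1, hb', hl]; push_cast; ring)
  have hperm : (finRange n).map e.symm ~ labels F := by
    rw [← h2, ← reduceOption_enc]
    exact hF.perm.filterMap _
  refine ⟨F, ⟨hperm.nodup_iff.1 ((nodup_finRange n).map e.symm.injective), fun v => ?_⟩,
    h1 ▸ hF.map _⟩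
  exact hperm.mem_iff.1 (mem_map.2 ⟨e v, by simp, by simp⟩)

end Forest

end ClusterQuiver

/-! ### Counting balanced binary necklaces. -/

namespace ClusterQuiver

open List

/-- The binary words of length `2 n` with `n` letters of each kind. -/
abbrev BalancedWord (n : ℕ) := {l : List Bool // l.length = 2 * n ∧ l.count true = n}

namespace BalancedWord

variable {n : ℕ}

theorem ncard_count (e c : ℕ) :
    {u : List Bool | u.length = e ∧ u.count true = c}.ncard = e.choose c := by
  induction e generalizing c with
  | zero =>
    rcases c with _ | c
    · have : {u : List Bool | u.length = 0 ∧ u.count true = 0} = {[]} := by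
        ext u
        simp only [length_eq_zero_iff, Set.mem_ofPred_eq, Set.mem_singleton_iff,
          and_iff_left_iff_imp]
        rintro rfl
        rfl
      rw [this]
      simp
    · have : {u : List Bool | u.length = 0 ∧ u.count true = c + 1} = ∅ := by
        ext u
        simp only [length_eq_zero_iff, Set.mem_ofPred_eq, Set.mem_empty_iff_false, iff_false]
        rintro ⟨rfl, h⟩
        simp at h
      rw [this]
      simp
  | succ e ih =>
    have hfin (e c : ℕ) : {u : List Bool | u.length = e ∧ u.count true = c}.Finite :=
      (List.finite_length_eq Bool e).subset fun u hu => hu.1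
    rcases c with _ | c
    · have : {u : List Bool | u.length = e + 1 ∧ u.count true = 0} =
          cons false '' {u : List Bool | u.length = e ∧ u.count true = 0} := by
        ext u
        rcases u with _ | ⟨_ | _, u⟩ <;> simp
      rw [this, Set.ncard_image_of_injective _ (cons_injective), ih]
      simp
    · have : {u : List Bool | u.length = e + 1 ∧ u.count true = c + 1} =
          cons true '' {u : List Bool | u.length = e ∧ u.count true = c} ∪
          cons false '' {u : List Bool | u.length = e ∧ u.count true = c + 1} := by
        ext u
        rcases u with _ | ⟨_ | _, u⟩ <;> simp
      rw [this, Set.ncard_union_eq ?_ ((hfin _ _).image _) ((hfin _ _).image _),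
        Set.ncard_image_of_injective _ (cons_injective),
        Set.ncard_image_of_injective _ (cons_injective), ih, ih, Nat.choose_succ_succ]
      rw [Set.disjoint_left]
      rintro _ ⟨u, -, rfl⟩ ⟨v, -, h⟩
      simp at h

theorem eq_flatten_of_commute {α : Type*} {u v : List α} {m : ℕ} (h : v ++ u = u ++ v)
    (hv : v.length = m * u.length) : v = (replicate m u).flatten := by
  induction m generalizing v with
  | zero => simpa using hv
  | succ m ih =>
    have hp : u <+: v := prefix_of_prefix_length_le (h ▸ prefix_append u v) (prefix_append v u)
      (by rw [hv]; exact Nat.le_mul_of_pos_left _ (Nat.succ_pos m))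
    obtain ⟨w, rfl⟩ := hp
    rw [append_assoc, append_cancel_left_eq] at h
    rw [replicate_succ, flatten_cons, ← ih h]
    rw [length_append] at hv
    have : (m + 1) * u.length = m * u.length + u.length := by ring
    omega

theorem rotate_mul_of_rotate {α : Type*} {l : List α} {k : ℕ} (h : l.rotate k = l) (a : ℕ) :
    l.rotate (k * a) = l := by
  induction a with
  | zero => simp
  | succ a ih => rw [Nat.mul_succ, ← rotate_rotate, ih, h]

/-- By Bézout the gcd is a multiple of `k` modulo the length. -/
theorem rotate_gcd_of_rotate {α : Type*} {l : List α} {k : ℕ} (h : l.rotate k = l) :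
    l.rotate (Nat.gcd k l.length) = l := by
  rcases Nat.eq_zero_or_pos l.length with h0 | h0
  · rw [length_eq_zero_iff.1 h0]; simp
  · rcases (Nat.le_of_dvd h0 (Nat.gcd_dvd_right k _)).eq_or_lt with h1 | h1
    · rw [h1, rotate_length]
    · obtain ⟨a, -, ha⟩ := Nat.exists_mul_mod_eq_gcd h1
      rw [← ha, rotate_mod, rotate_mul_of_rotate h]

theorem flatten_replicate_rotate {α : Type*} (u : List α) (m : ℕ) :
    (replicate m u).flatten.rotate u.length = (replicate m u).flatten := by
  rcases m with _ | m
  · simp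
  · rw [replicate_succ, flatten_cons, rotate_append_length_eq, ← flatten_concat,
      ← replicate_succ', replicate_succ, flatten_cons]

/-- The words which are fixed by the rotation by `k` are periodic. -/
theorem ncard_fixed (hn : 0 < n) (k : ℕ) :
    {l : List Bool | (l.length = 2 * n ∧ l.count true = n) ∧ l.rotate k = l}.ncard =
      if 2 ∣ Nat.gcd (2 * n) k then (Nat.gcd (2 * n) k).choose (Nat.gcd (2 * n) k / 2) else 0 := by
  set e := Nat.gcd (2 * n) k with he
  obtain ⟨m, hm⟩ : e ∣ 2 * n := Nat.gcd_dvd_left _ _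
  have hm0 : 0 < m := by
    rcases m with _ | m
    · omega
    · exact Nat.succ_pos m
  have hcount (c : ℕ) : m * c = n ↔ 2 * c = e := by
    constructor
    · intro h
      apply Nat.eq_of_mul_eq_mul_left hm0
      rw [mul_comm m e, ← hm, ← h]
      ring
    · intro h
      rw [← h] at hm
      have : 2 * (m * c) = 2 * n := by rw [hm]; ring
      omega
  -- A fixed word has period `e`, hence is the `m`-th power of its first `e` letters. These must be
  -- balanced themselves, so nothing is fixed when `e` is odd.
  have himage : {l : List Bool | (l.length = 2 * n ∧ l.count true = n) ∧ l.rotate k = l} =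
      (fun u => (replicate m u).flatten) ''
        {u : List Bool | u.length = e ∧ 2 * u.count true = e} := by
    ext l
    simp only [Set.mem_ofPred_eq, Set.mem_image]
    constructor
    · rintro ⟨⟨h1, h2⟩, h3⟩
      have h4 := rotate_gcd_of_rotate h3
      rw [h1, Nat.gcd_comm, ← he] at h4
      have hel : e ≤ l.length := by
        rw [h1, hm]
        exact Nat.le_mul_of_pos_right _ hm0
      rw [rotate_eq_drop_append_take hel] at h4
      have hlen : (l.take e).length = e := by rw [length_take]; omega
      have h5 : l = (replicate m (l.take e)).flatten := by
        apply eq_flatten_of_commute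
        · calc l ++ l.take e = (l.take e ++ l.drop e) ++ l.take e := by rw [take_append_drop]
            _ = l.take e ++ l := by rw [append_assoc, h4]
        · rw [h1, hm, hlen, mul_comm]
      refine ⟨l.take e, ⟨hlen, ?_⟩, h5.symm⟩
      rw [← hcount, ← h2, ← smul_eq_mul, ← sum_replicate, ← map_replicate, ← count_flatten, ← h5]
    · rintro ⟨u, ⟨h1, h2⟩, rfl⟩
      refine ⟨⟨?_, ?_⟩, ?_⟩
      · rw [length_flatten, map_replicate, sum_replicate, smul_eq_mul, h1, hm, mul_comm]
      · rw [count_flatten, map_replicate, sum_replicate, smul_eq_mul, (hcount _).2 h2]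
      · obtain ⟨a, ha⟩ : e ∣ k := Nat.gcd_dvd_right _ _
        rw [ha]
        apply rotate_mul_of_rotate
        rw [← h1]
        exact flatten_replicate_rotate u m
  have hinj : Set.InjOn (fun u : List Bool => (replicate m u).flatten)
      {u : List Bool | u.length = e ∧ 2 * u.count true = e} := by
    intro u hu v hv h
    obtain ⟨m, rfl⟩ := Nat.exists_eq_succ_of_ne_zero hm0.ne'
    simp only [replicate_succ, flatten_cons] at h
    exact (append_inj h (hu.1.trans hv.1.symm)).1
  rw [himage, hinj.ncard_image]
  split_ifs with h2
  · obtain ⟨d, hd⟩ := h2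
    rw [hd, Nat.mul_div_cancel_left _ two_pos, ← ncard_count]
    congr 1
    ext u
    simp
  · convert Set.ncard_empty (List Bool)
    ext u
    simp only [Set.mem_ofPred_eq, Set.mem_empty_iff_false, iff_false]
    rintro ⟨-, h⟩
    exact h2 ⟨_, h.symm⟩

/-- The `k` with gcd equal to `e` number `φ(2n / e)`; only even `e` contribute, and these are `e =
2d` with `d ∣ n`. -/
theorem sum_gcd (hn : 0 < n) :
    ∑ k ∈ Finset.range (2 * n), (if 2 ∣ Nat.gcd (2 * n) k then
      (Nat.gcd (2 * n) k).choose (Nat.gcd (2 * n) k / 2) else 0) =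
    ∑ d ∈ n.divisors, Nat.totient (n / d) * Nat.choose (2 * d) d := by
  have h1 : ∀ k ∈ Finset.range (2 * n), Nat.gcd (2 * n) k ∈ (2 * n).divisors := fun k _ =>
    Nat.mem_divisors.2 ⟨Nat.gcd_dvd_left _ _, by omega⟩
  rw [← Finset.sum_fiberwise_of_maps_to h1]
  have h2 : ∀ e ∈ (2 * n).divisors, (∑ k ∈ (Finset.range (2 * n)).filter (fun k =>
      Nat.gcd (2 * n) k = e), (if 2 ∣ Nat.gcd (2 * n) k then
      (Nat.gcd (2 * n) k).choose (Nat.gcd (2 * n) k / 2) else 0)) =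
      if 2 ∣ e then Nat.totient (2 * n / e) * e.choose (e / 2) else 0 := by
    intro e he
    rw [Finset.sum_congr rfl (g := fun _ => if 2 ∣ e then e.choose (e / 2) else 0)
      (fun k hk => by rw [(Finset.mem_filter.1 hk).2]), Finset.sum_const, smul_eq_mul,
      ← Nat.totient_div_of_dvd (Nat.dvd_of_mem_divisors he)]
    split_ifs <;> simp
  rw [Finset.sum_congr rfl h2, ← Finset.sum_filter]
  symm
  refine Finset.sum_bij (fun d _ => 2 * d) ?_ ?_ ?_ ?_
  · intro d hd
    have := Nat.dvd_of_mem_divisors hd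
    simp only [Finset.mem_filter, Nat.mem_divisors]
    exact ⟨⟨Nat.mul_dvd_mul_left 2 this, by omega⟩, dvd_mul_right 2 d⟩
  · intro a _ b _ h
    omega
  · intro e he
    simp only [Finset.mem_filter, Nat.mem_divisors] at he
    obtain ⟨⟨h, -⟩, d, rfl⟩ := he
    exact ⟨d, Nat.mem_divisors.2 ⟨Nat.dvd_of_mul_dvd_mul_left two_pos h, hn.ne'⟩, rfl⟩
  · intro d _
    rw [Nat.mul_div_mul_left _ _ two_pos, Nat.mul_div_cancel_left _ two_pos]

/-- The rotation action of `ZMod (2 * n)` on balanced words. -/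
instance [NeZero (2 * n)] : AddAction (ZMod (2 * n)) (BalancedWord n) where
  vadd g l := ⟨l.1.rotate g.val, by rw [length_rotate]; exact l.2.1,
    by rw [(rotate_perm l.1 _).count_eq]; exact l.2.2⟩
  zero_vadd l := Subtype.ext (by
    change l.1.rotate (0 : ZMod (2 * n)).val = l.1
    rw [ZMod.val_zero, rotate_zero])
  add_vadd g h l := Subtype.ext (by
    change l.1.rotate (g + h).val = (l.1.rotate h.val).rotate g.val
    have := rotate_mod l.1 (g.val + h.val)
    rw [l.2.1] at this
    rw [ZMod.val_add, rotate_rotate, this, add_comm])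

theorem vadd_val [NeZero (2 * n)] (g : ZMod (2 * n)) (l : BalancedWord n) :
    (g +ᵥ l).1 = l.1.rotate g.val := rfl

/-- Balanced words up to rotation. -/
def rotationSetoid (n : ℕ) : Setoid (BalancedWord n) := (IsRotated.setoid Bool).comap Subtype.val

instance : Finite (BalancedWord n) :=
  Set.Finite.to_subtype ((List.finite_length_eq Bool (2 * n)).subset fun _ hu => hu.1)

theorem rotationSetoid_eq [NeZero (2 * n)] :
    rotationSetoid n = AddAction.orbitRel (ZMod (2 * n)) (BalancedWord n) := by
  ext l m
  rw [AddAction.orbitRel_apply, AddAction.mem_orbit_iff]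
  change l.1 ~r m.1 ↔ _
  rw [isRotated_comm]
  constructor
  · rintro ⟨k, hk⟩
    refine ⟨(k : ZMod (2 * n)), Subtype.ext ?_⟩
    have := rotate_mod m.1 k
    rw [m.2.1] at this
    rw [vadd_val, ZMod.val_natCast, this, hk]
  · rintro ⟨g, rfl⟩
    exact ⟨g.val, rfl⟩

theorem sum_zmod {N : ℕ} [NeZero N] (f : ℕ → ℕ) :
    ∑ g : ZMod N, f g.val = ∑ k ∈ Finset.range N, f k := by
  rcases N with _ | N
  · exact absurd rfl (NeZero.ne 0)
  · exact Fin.sum_univ_eq_sum_range f (N + 1)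

/-- The number of binary necklaces with `n` beads of each colour. -/
theorem card_necklaces (hn : 0 < n) : Nat.card (Quotient (rotationSetoid n)) * (2 * n) =
    ∑ d ∈ n.divisors, Nat.totient (n / d) * Nat.choose (2 * d) d := by
  classical
  have : NeZero (2 * n) := ⟨by omega⟩
  have := Fintype.ofFinite (BalancedWord n)
  rw [rotationSetoid_eq, ← sum_gcd hn]
  have := Fintype.ofFinite (Quotient (AddAction.orbitRel (ZMod (2 * n)) (BalancedWord n)))
  have h := AddAction.sum_card_fixedBy_eq_card_orbits_mul_card_addGroup (ZMod (2 * n))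
    (BalancedWord n)
  rw [ZMod.card] at h
  rw [Nat.card_eq_fintype_card, ← h]
  have hfix (g : ZMod (2 * n)) : Fintype.card (AddAction.fixedBy (BalancedWord n) g) =
      if 2 ∣ Nat.gcd (2 * n) g.val then
        (Nat.gcd (2 * n) g.val).choose (Nat.gcd (2 * n) g.val / 2) else 0 := by
    rw [← ncard_fixed hn, ← Nat.card_eq_fintype_card, Nat.card_coe_set_eq,
      ← Set.ncard_image_of_injective _ Subtype.val_injective]
    congr 1
    ext l
    simp only [Set.mem_image, AddAction.mem_fixedBy, Set.mem_ofPred_eq]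
    constructor
    · rintro ⟨m, hm, rfl⟩
      exact ⟨m.2, congrArg Subtype.val hm⟩
    · rintro ⟨h1, h2⟩
      exact ⟨⟨l, h1⟩, Subtype.ext h2, rfl⟩
  rw [Finset.sum_congr rfl fun g _ => hfix g, sum_zmod (N := 2 * n) fun k =>
    if 2 ∣ Nat.gcd (2 * n) k then (Nat.gcd (2 * n) k).choose (Nat.gcd (2 * n) k / 2) else 0]

end BalancedWord

end ClusterQuiver

/-! ### Type D_4: an explicit list of six quivers. -/

namespace ClusterQuiver

open Relation

variable {V : Type*}

/-- Representatives of the six isomorphism classes of quivers of type `D_4`. -/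
def typeFour : Fin 6 → Fin 4 → Fin 4 → ℕ :=
  ![![![0, 1, 1, 1], ![0, 0, 0, 0], ![0, 0, 0, 0], ![0, 0, 0, 0]],
    ![![0, 0, 0, 0], ![1, 0, 0, 0], ![1, 0, 0, 0], ![1, 0, 0, 0]],
    ![![0, 0, 1, 1], ![1, 0, 0, 0], ![0, 0, 0, 0], ![0, 0, 0, 0]],
    ![![0, 0, 0, 1], ![1, 0, 0, 0], ![1, 0, 0, 0], ![0, 0, 0, 0]],
    ![![0, 1, 0, 0], ![0, 0, 1, 0], ![0, 0, 0, 1], ![1, 0, 0, 0]],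
    ![![0, 1, 0, 0], ![0, 0, 1, 1], ![1, 0, 0, 0], ![1, 0, 0, 0]]]

/-- The type of the mutation of a quiver of type `D_4`. -/
def typeFourNext : Fin 6 → Fin 4 → Fin 6 :=
  ![![1, 2, 2, 2], ![0, 3, 3, 3], ![5, 0, 3, 3], ![5, 2, 2, 1], ![5, 5, 5, 5], ![2, 3, 4, 4]]

/-- The isomorphism of the mutation of a quiver of type `D_4` with a representative. -/
def typeFourPerm : Fin 6 → Fin 4 → Fin 4 → Fin 4 :=
  ![![![0, 1, 2, 3], ![0, 1, 2, 3], ![0, 2, 1, 3], ![0, 2, 3, 1]],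
    ![![0, 1, 2, 3], ![0, 3, 1, 2], ![0, 1, 3, 2], ![0, 1, 2, 3]],
    ![![0, 1, 2, 3], ![0, 1, 2, 3], ![0, 1, 2, 3], ![0, 1, 3, 2]],
    ![![1, 2, 3, 0], ![0, 2, 1, 3], ![0, 1, 2, 3], ![0, 1, 2, 3]],
    ![![2, 1, 3, 0], ![0, 2, 1, 3], ![2, 0, 3, 1], ![1, 2, 0, 3]],
    ![![0, 1, 2, 3], ![3, 0, 1, 2], ![0, 2, 1, 3], ![0, 2, 3, 1]]]

theorem typeFourPerm_injective : ∀ k v, Function.Injective (typeFourPerm k v) := by decide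

theorem typeFour_next : ∀ k v i j,
    (if i = v ∨ j = v then typeFour k j i
      else (typeFour k i j + typeFour k i v * typeFour k v j) -
        (typeFour k j i + typeFour k j v * typeFour k v i)) =
    typeFour (typeFourNext k v) (typeFourPerm k v i) (typeFourPerm k v j) := by decide

/-- `Q` is isomorphic to the representative with number `k`. -/
def HasTypeFour (Q : ClusterQuiver V) (k : Fin 6) : Prop :=
  ∃ e : V ≃ Fin 4, ∀ i j, Q.arrows i j = typeFour k (e i) (e j)

theorem HasTypeFour.of_injective {Q : ClusterQuiver V} {k : Fin 6} (e : V ≃ Fin 4)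
    {f : Fin 4 → Fin 4} (hf : Function.Injective f)
    (h : ∀ i j, Q.arrows i j = typeFour k (f (e i)) (f (e j))) : Q.HasTypeFour k :=
  ⟨e.trans (Equiv.ofBijective f (Finite.injective_iff_bijective.1 hf)), h⟩

theorem HasTypeFour.mutate [DecidableEq V] {Q : ClusterQuiver V} {k : Fin 6} {e : V ≃ Fin 4}
    (h : ∀ i j, Q.arrows i j = typeFour k (e i) (e j)) (x : V) :
    (Q.mutate x).HasTypeFour (typeFourNext k (e x)) := by
  refine .of_injective e (typeFourPerm_injective k (e x)) fun i j => ?_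
  rw [← typeFour_next]
  simp only [ClusterQuiver.mutate, h, EmbeddingLike.apply_eq_iff_eq]

theorem HasTypeFour.foldl [DecidableEq V] {Q : ClusterQuiver V} {k : Fin 6}
    (h : Q.HasTypeFour k) (l : List (Fin 4)) :
    ∃ Q', Q.MutationEquiv Q' ∧ Q'.HasTypeFour (l.foldl typeFourNext k) := by
  induction l generalizing Q k with
  | nil => exact ⟨Q, .refl, h⟩
  | cons v l ih =>
    obtain ⟨e, he⟩ := h
    have h1 := HasTypeFour.mutate he (e.symm v)
    rw [Equiv.apply_symm_apply] at h1
    obtain ⟨Q', h2, h3⟩ := ih h1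
    exact ⟨Q', .head ⟨_, rfl⟩ h2, h3⟩

/-- Explicit mutation sequences lead from each type to type `0` and back. -/
theorem typeFour_connected (k k' : Fin 6) : ∃ l : List (Fin 4), l.foldl typeFourNext k = k' := by
  have h1 : ∀ k, (![[], [0], [1], [1, 1], [0, 0, 1], [0, 1]] k : List (Fin 4)).foldl
    typeFourNext k = 0 := by decide
  have h2 : ∀ k, (![[], [0], [1], [0, 1], [1, 0, 2], [1, 0]] k : List (Fin 4)).foldl
    typeFourNext 0 = k := by decide
  exact ⟨_ ++ _, by rw [List.foldl_append, h1 k, h2 k']⟩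

theorem HasTypeFour.of_mutationEquiv [DecidableEq V] {Q Q' : ClusterQuiver V} {k : Fin 6}
    (h : Q.HasTypeFour k) (hQ : Q.MutationEquiv Q') : ∃ k', Q'.HasTypeFour k' := by
  induction hQ with
  | refl => exact ⟨k, h⟩
  | tail _ h ih =>
    obtain ⟨x, rfl⟩ := h
    obtain ⟨k', e, he⟩ := ih
    exact ⟨_, HasTypeFour.mutate he x⟩

/-- An isomorphism invariant which separates the quivers of type `D_4`. -/
def degreeInvariant (a : Fin 4 → Fin 4 → ℕ) : ℕ :=
  ∑ i, ((∑ j, a i j) ^ 2 + 7 * (∑ j, a j i) ^ 2)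

theorem degreeInvariant_perm (a : Fin 4 → Fin 4 → ℕ) (σ : Equiv.Perm (Fin 4)) :
    degreeInvariant (fun i j => a (σ i) (σ j)) = degreeInvariant a := by
  unfold degreeInvariant
  rw [← Equiv.sum_comp σ fun i => ((∑ j, a i j) ^ 2 + 7 * (∑ j, a j i) ^ 2)]
  refine Finset.sum_congr rfl fun i _ => ?_
  rw [Equiv.sum_comp σ fun j => a (σ i) j, Equiv.sum_comp σ fun j => a j (σ i)]

/-- The six values are 30, 66, 26, 38, 32, 56. Types `0`, `1` and types `2`, `3` are pairs of
opposite quivers, so in-degrees and out-degrees need different weights. -/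
theorem degreeInvariant_injective :
    ∀ k k', degreeInvariant (typeFour k) = degreeInvariant (typeFour k') → k = k' := by decide

theorem HasTypeFour.unique {Q Q' : ClusterQuiver V} {k k' : Fin 6} (h : Q.HasTypeFour k)
    (h' : Q'.HasTypeFour k') (hQ : (isoSetoid V) Q Q') : k = k' := by
  obtain ⟨e, he⟩ := h
  obtain ⟨e', he'⟩ := h'
  obtain ⟨σ, hσ⟩ := hQ
  apply degreeInvariant_injective
  rw [← degreeInvariant_perm (typeFour k') ((e.symm.trans σ).trans e')]
  congr 1
  funext i j
  simp only [Equiv.trans_apply, ← he', hσ, he, Equiv.apply_symm_apply]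

theorem HasTypeFour.iso {Q Q' : ClusterQuiver V} {k : Fin 6} (h : Q.HasTypeFour k)
    (h' : Q'.HasTypeFour k) : (isoSetoid V) Q Q' := by
  obtain ⟨e, he⟩ := h
  obtain ⟨e', he'⟩ := h'
  exact ⟨e.trans e'.symm, fun i j => by simp [he, he']⟩

theorem IsDynkinD.exists_hasTypeFour {Q : ClusterQuiver V} (hQ : Q.IsDynkinD 4) :
    ∃ k, Q.HasTypeFour k := by
  obtain ⟨e, he⟩ := hQ
  set a : Fin 4 → Fin 4 → ℕ := fun i j => Q.arrows (e.symm i) (e.symm j) with ha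
  have haQ (i j : V) : Q.arrows i j = a (e i) (e j) := by simp [ha]
  have h0 (i : Fin 4) : a i i = 0 := Q.no_loop _
  have h1 (i j : Fin 4) (hij : i ≠ j) : (a i j : ℤ) + a j i = -CartanMatrix.D 4 i j := by
    have := he (e.symm i) (e.symm j) (by simpa using hij)
    simpa using this
  have h01 : (a 0 1 : ℤ) + a 1 0 = 1 := h1 0 1 (by decide)
  have h02 : (a 0 2 : ℤ) + a 2 0 = 0 := h1 0 2 (by decide)
  have h03 : (a 0 3 : ℤ) + a 3 0 = 0 := h1 0 3 (by decide)
  have h12 : (a 1 2 : ℤ) + a 2 1 = 1 := h1 1 2 (by decide)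
  have h13 : (a 1 3 : ℤ) + a 3 1 = 1 := h1 1 3 (by decide)
  have h23 : (a 2 3 : ℤ) + a 3 2 = 0 := h1 2 3 (by decide)
  -- Vertex `1` is the centre of D_4, and only the directions of its three edges are free.
  have hM : a = ![![0, 1 - a 1 0, 0, 0], ![a 1 0, 0, a 1 2, a 1 3], ![0, 1 - a 1 2, 0, 0],
      ![0, 1 - a 1 3, 0, 0]] := by
    funext i j
    fin_cases i <;> fin_cases j <;> simp [h0] <;> omega
  have c1 : a 1 0 = 0 ∨ a 1 0 = 1 := by omega
  have c2 : a 1 2 = 0 ∨ a 1 2 = 1 := by omega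
  have c3 : a 1 3 = 0 ∨ a 1 3 = 1 := by omega
  have key {k : Fin 6} (f : Fin 4 → Fin 4) (hf : Function.Injective f)
      (h : ∀ i j, a i j = typeFour k (f i) (f j)) : ∃ k, Q.HasTypeFour k :=
    ⟨k, .of_injective e hf fun i j => by rw [haQ, h]⟩
  rcases c1 with c1 | c1 <;> rcases c2 with c2 | c2 <;> rcases c3 with c3 | c3 <;>
    rw [c1, c2, c3] at hM <;> rw [hM] at key
  · exact key (k := 1) ![1, 0, 2, 3] (by decide) (by decide)
  · exact key (k := 3) ![1, 0, 2, 3] (by decide) (by decide)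
  · exact key (k := 3) ![1, 0, 3, 2] (by decide) (by decide)
  · exact key (k := 2) ![1, 0, 2, 3] (by decide) (by decide)
  · exact key (k := 3) ![3, 0, 1, 2] (by decide) (by decide)
  · exact key (k := 2) ![2, 0, 1, 3] (by decide) (by decide)
  · exact key (k := 2) ![2, 0, 3, 1] (by decide) (by decide)
  · exact key (k := 0) ![1, 0, 2, 3] (by decide) (by decide)

theorem card_mutationIsoClasses_four [DecidableEq V] {Q : ClusterQuiver V} (hQ : Q.IsOfTypeD 4) :
    Nat.card Q.MutationIsoClasses = 6 := by
  obtain ⟨Q₀, h0, h1⟩ := hQ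
  obtain ⟨k₀, hk₀⟩ := h0.exists_hasTypeFour
  obtain ⟨k₁, hk₁⟩ := hk₀.of_mutationEquiv h1
  have hex (Q' : Q.mutationClass) : ∃ k, Q'.1.HasTypeFour k := hk₁.of_mutationEquiv Q'.2
  choose g hg using hex
  let f : Q.MutationIsoClasses → Fin 6 :=
    Quotient.lift g fun Q₁ Q₂ h => (hg Q₁).unique (hg Q₂) h
  have hf : Function.Bijective f := by
    constructor
    · rintro ⟨Q₁⟩ ⟨Q₂⟩ h
      change g Q₁ = g Q₂ at h
      exact Quotient.sound ((hg Q₁).iso (h ▸ hg Q₂))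
    · intro k
      obtain ⟨l, hl⟩ := typeFour_connected k₁ k
      obtain ⟨Q', h2, h3⟩ := hk₁.foldl l
      refine ⟨Quotient.mk _ ⟨Q', h2⟩, ?_⟩
      change g ⟨Q', h2⟩ = k
      rw [← hl]
      exact (hg ⟨Q', h2⟩).unique h3 ((isoSetoid V).refl Q')
  rw [Nat.card_eq_of_bijective f hf, Nat.card_fin]

end ClusterQuiver

/-! ### Isomorphism classes as necklaces for n ≥ 5, and the conclusion. -/

namespace ClusterQuiver

open List Forest

variable {V : Type*} [DecidableEq V]

/-- A quiver is sent to the shape of a chosen forest. Rigidity makes its rotation class an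
isomorphism invariant, rotated shapes give forests that agree up to relabelling and rotation, and
flips reach every shape. -/
theorem card_mutationIsoClasses_of_five_le {n : ℕ} (hn : 5 ≤ n) {Q : ClusterQuiver V}
    (hQ : Q.IsOfTypeD n) :
    Nat.card Q.MutationIsoClasses = Nat.card (Quotient (BalancedWord.rotationSetoid n)) := by
  obtain ⟨Q₀, h0, h1⟩ := hQ
  obtain ⟨F₀, hF₀, hQF₀⟩ := h0.exists_forest (by omega)
  obtain ⟨e, -⟩ := h0
  have hlen {F : Forest V} (hF : Valid F) : (labels F).length = n := hF.length_eq e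
  have hex {Q' : ClusterQuiver V} (h : Q₀.MutationEquiv Q') :
      ∃ G, Valid G ∧ G ≠ [] ∧ Q'.skew = mat G :=
    exists_skew_eq_of_mutationEquiv hF₀ (by rw [hlen hF₀]; omega) hQF₀ h
  have hclass (Q' : Q.mutationClass) : Q₀.MutationEquiv Q'.1 := h1.trans Q'.2
  choose G hG hG0 hQG using fun Q' : Q.mutationClass => hex (hclass Q')
  have hrigid (Q' : Q.mutationClass) : Q'.1.Rigid := rigid_of_skew_eq_mat e hn (hG Q') (hQG Q')
  have hword {F : Forest V} (hF : Valid F) :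
      (shape F).length = 2 * n ∧ (shape F).count true = n := by
    rw [length_shape, count_shape, hlen hF]
    exact ⟨rfl, rfl⟩
  let g : Q.mutationClass → BalancedWord n := fun Q' => ⟨shape (G Q'), hword (hG Q')⟩
  have hg (Q₁ Q₂ : Q.mutationClass) (h : (isoSetoid V) Q₁.1 Q₂.1) : (g Q₁).1 ~r (g Q₂).1 := by
    obtain ⟨σ, hσ⟩ := h
    have h2 : Q₂.1.skew = mat (relabel σ (G Q₁)) := by
      funext i j
      rw [← σ.apply_symm_apply i, ← σ.apply_symm_apply j, mat_relabel, ← hQG Q₁, skew, skew, hσ, hσ]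
    have h3 := (hrigid Q₂ _ _ ((hG Q₁).relabel σ) (hG Q₂) h2 (hQG Q₂)).shape
    rwa [shape_relabel] at h3
  have hg' (Q₁ Q₂ : Q.mutationClass) (h : (g Q₁).1 ~r (g Q₂).1) : (isoSetoid V) Q₁.1 Q₂.1 := by
    obtain ⟨σ, hσ⟩ := exists_relabel_isRotated (hG Q₁) (hG Q₂) h
    refine ⟨σ, fun i j => ?_⟩
    have h2 : Q₂.1.skew (σ i) (σ j) = Q₁.1.skew i j := by
      rw [hQG Q₂, ← mat_eq_of_isRotated hσ, mat_relabel, hQG Q₁]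
    have h3 := arrows_eq_max Q₂.1 (σ i) (σ j)
    rw [h2, ← arrows_eq_max] at h3
    exact_mod_cast h3
  let f : Q.MutationIsoClasses → Quotient (BalancedWord.rotationSetoid n) :=
    Quotient.lift (fun Q' => Quotient.mk _ (g Q')) fun Q₁ Q₂ h => Quotient.sound (hg Q₁ Q₂ h)
  refine Nat.card_eq_of_bijective f ⟨?_, ?_⟩
  · rintro ⟨Q₁⟩ ⟨Q₂⟩ h
    exact Quotient.sound (hg' Q₁ Q₂ (Quotient.exact h))
  · rintro ⟨b⟩
    obtain ⟨F, hF, hbF⟩ := exists_valid_shape e b.2.1 b.2.2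
    have hF0 : F ≠ [] := by
      rintro rfl
      have := hlen hF
      simp at this
      omega
    let Q₁ : Q.mutationClass := ⟨Q, .refl⟩
    obtain ⟨σ, hσ⟩ := exists_reach_relabel (hG Q₁) hF (hG0 Q₁) hF0
    obtain ⟨Q', h2, h3⟩ := hσ.exists_skew_eq (hG Q₁).1 (hQG Q₁)
    let Q₂ : Q.mutationClass := ⟨Q', h2⟩
    refine ⟨Quotient.mk _ Q₂, Quotient.sound ?_⟩
    have h4 := (hrigid Q₂ _ _ (hG Q₂) (hF.relabel σ) (hQG Q₂) h3).shape
    rw [shape_relabel] at h4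
    exact h4.trans hbF.symm

end ClusterQuiver

theorem mainTheorem1 {V : Type*} [DecidableEq V] (n : ℕ) (hn : 4 ≤ n)
    (Q : ClusterQuiver V) (hQ : Q.IsOfTypeD n) :
    Finite Q.MutationIsoClasses ∧
    (5 ≤ n → (Nat.card Q.MutationIsoClasses : ℚ) =
      (∑ d ∈ n.divisors, (Nat.totient (n / d) : ℚ) * (Nat.choose (2 * d) d : ℚ)) / (2 * (n : ℚ))) ∧
    (n = 4 → Nat.card Q.MutationIsoClasses = 6) := by
  have h5 (h : 5 ≤ n)  :=
    ClusterQuiver.card_mutationIsoClasses_of_five_le h hQ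
  have h4 : n = 4 → Nat.card Q.MutationIsoClasses = 6 := by
    rintro rfl
    exact ClusterQuiver.card_mutationIsoClasses_four hQ
  refine ⟨?_, fun h => ?_, h4⟩
  -- `Nat.card` is `0` on infinite types, so finiteness follows from the count being nonzero.
  · apply Nat.finite_of_card_ne_zero
    rcases hn.eq_or_lt with h | h
    · rw [h4 h.symm]
      decide
    · rw [h5 h]
      have : Nonempty (Quotient (ClusterQuiver.BalancedWord.rotationSetoid n)) :=
        ⟨Quotient.mk _ ⟨List.replicate n true ++ List.replicate n false,
          by simp; omega, by simp [List.count_replicate]⟩⟩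
      exact Nat.card_pos.ne'
  · rw [eq_div_iff (by positivity), h5 h]
    exact_mod_cast ClusterQuiver.BalancedWord.card_necklaces (n := n) (by omega)
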